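/- **Setting.** A wireless powered network has nodes $n=1,\dots,N$, data links $l=1,\dots,L$ with transmitter $T(l)$ and receiver $R(l)$ ($\mathcal O_n$, $\mathcal I_n$ are the links leaving and entering $n$), streams $s=1,\dots,S$ with distinct source $\mathrm{src}(s)$ and destination $\mathrm{dst}(s)$, and an energy access point (EAP) with $M$ antennas. In slot $t=0,1,\dots$ the state is $X(t)=(\mathbf h_1(t),\dots,\mathbf h_N(t),\mathbf g(t),A(t))$: energy-channel vectors $\mathbf h_n(t)$ with $M$ real or complex entries, data channels $\mathbf g(t)$, and arrivals $A_n^s(t)\in[0,A_{\rm m}]$ that vanish unless $n=\mathrm{src}(s)$. The states $X(t)$ are i.i.d. over the slots, with $\mathbb E\|\mathbf h_n\|^2<\infty$; put $\lambda_n^s=\mathbb E A_n^s(t)$. In each slot the controller chooses an EAP power $p_{AP}(t)\in[0,P_{\rm APm}]$, a beamforming vector $\mathbf w(t)$ with $\|\mathbf w(t)\|=1$, a power vector $\mathbf p(t)\in\Pi$ and rates $C_l^s(t)\ge0$ with $\sum_s C_l^s(t)\le C_l(\mathbf p(t),\mathbf g(t))$. Here $\Pi\subseteq[0,P_{\rm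 m}]^L$ is nonempty, closed, and stable under setting entries to zero; the capacity functions $C_l\ge 0$ are bounded, jointly measurable, and upper semicontinuous in $\mathbf p\in\Pi$ (for example continuous), satisfy $C_l(\mathbf p,\mathbf g)\le\delta p_l$ for some $\delta>0$, and setting $p_l$ to zero makes $C_l$ zero and does not decrease $C_{l'}$ for $l'\ne l$. Node $n$ receives the power $Q_n(t)=p_{AP}(t)\,|\mathbf w(t)\mathbf h_n^T(t)|^2$. From given initial backlogs $U_n^s(0)\ge0$, the queues evolve, for $n\ne\mathrm{dst}(s)$, by $$U_n^s(t+1)=\Big[U_n^s(t)-\sum_{l\in\mathcal O_n}C_l^s(t)\Big]^++\sum_{l\in\mathcal I_n}C_l^s(t)+A_n^s(t),$$ and $U_{\mathrm{dst}(s)}^s(t)=0$ (delivered data leave the network). A *policy* is any rule for these choices, possibly randomized, nonstationary and history dependent, such that $X(t)$ is independent of all earlier states and decisions. It is *stable* if $\limsup_{T\to\infty}\frac1T\sum_{t<T}\sum_{n,s}\mathbb E\,U_n^s(t)<\infty$, and satisfies the *average power constraint* if $\limsup_{T\to\infty}\frac1T\sum_{t<T}\mathbb E\big[\sum_{l\in\mathcal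 O_n}p_l(t)-Q_n(t)\big]\le0$ for all $n$. The arrival rates $\lambda$ belong to the capacity region $\Lambda$ if some stable policy for the given arrivals satisfies the average power constraint. The minimum power required for stability, $P^*_{AP}$, is the infimum of $\limsup_{T\to\infty}\frac1T\sum_{t<T}\mathbb E\,p_{AP}(t)$ over all stable policies that satisfy the average power constraint. **Theorem.** If $\lambda\in\Lambda$, then there is a stationary, possibly randomized policy, whose decision in slot $t$ is drawn from a fixed conditional distribution given $X(t)$, independently of all earlier states and decisions, with average EAP power equal to $P^*_{AP}$, and such that for all $t$ $$\mathbb E\,p_{AP}(t)=P^*_{AP},$$ $$\lambda_n^s+\sum_{l\in\mathcal I_n}\mathbb E\,C_l^s(t)\le\sum_{l\in\mathcal O_n}\mathbb E\,C_l^s(t)\quad\text{for all } n,s \text{ with } n\ne\mathrm{dst}(s),$$ $$\sum_{l\in\mathcal O_n}\mathbb E\,p_l(t)\le\mathbb E\,Q_n(t)\quad\text{for all } n.$$ -/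

import Mathlib

open MeasureTheory ProbabilityTheory Filter

/-- A wireless powered communication network with `N` nodes, `L` data links, `S` data streams and
an energy access point (EAP) with `M` antennas.  The scalar field `𝕜` (`ℝ` or `ℂ`) is the one of
the channel coefficients and of the beamforming vectors. -/
structure WPCN (𝕜 : Type) [RCLike 𝕜] (N L S M : ℕ) where
  /-- transmitter of a link -/
  T : Fin L → Fin N
  /-- receiver of a link -/
  R : Fin L → Fin N
  /-- source of a stream -/
  src : Fin S → Fin N
  /-- destination of a stream -/
  dst : Fin S → Fin N
  src_ne_dst : ∀ s, src s ≠ dst s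
  /-- peak transmission power of a link -/
  Pm : ℝ
  /-- peak transmission power of the EAP -/
  PAPm : ℝ
  /-- the set `Π` of feasible power vectors -/
  powerSet : Set (Fin L → ℝ)
  powerSet_nonempty : powerSet.Nonempty
  powerSet_closed : IsClosed powerSet
  powerSet_peak : ∀ p ∈ powerSet, ∀ l, p l ∈ Set.Icc 0 Pm
  powerSet_zero : ∀ p ∈ powerSet, ∀ l, Function.update p l 0 ∈ powerSet
  /-- the capacity `C_l(p, g)` of link `l` under powers `p` and data channels `g` -/
  cap : Fin L → (Fin L → ℝ) → (Fin L → 𝕜) → ℝ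
  cap_measurable : ∀ l, Measurable fun x : (Fin L → ℝ) × (Fin L → 𝕜) => cap l x.1 x.2
  cap_usc : ∀ l g, UpperSemicontinuousOn (fun p => cap l p g) powerSet
  cap_nonneg : ∀ l, ∀ p ∈ powerSet, ∀ g, 0 ≤ cap l p g
  cap_bounded : ∃ Cm > 0, ∀ l, ∀ p ∈ powerSet, ∀ g, cap l p g ≤ Cm
  cap_no_power : ∀ l, ∀ p ∈ powerSet, ∀ g, cap l (Function.update p l 0) g = 0
  cap_linear_bound : ∃ δ > 0, ∀ l, ∀ p ∈ powerSet, ∀ g, cap l p g ≤ δ * p l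
  cap_interference : ∀ l l', l' ≠ l → ∀ p ∈ powerSet, ∀ g,
    cap l' p g ≤ cap l' (Function.update p l 0) g
  /-- the initial backlogs of the data queues -/
  U0 : Fin N → Fin S → ℝ
  U0_nonneg : ∀ n s, 0 ≤ U0 n s

namespace WPCN

/-- The random state of a time slot: the energy channels `h n m` (node `n`, antenna `m`),
the data channels `g l`, and the arrivals `A n s` (node `n`, stream `s`). -/
abbrev State (𝕜 : Type) (N L S M : ℕ) : Type :=
  (Fin N → Fin M → 𝕜) × (Fin L → 𝕜) × (Fin N → Fin S → ℝ)

/-- The control decision of a time slot: the EAP power, the beamforming vector `w`, the link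
powers `p l`, and the rates `c l s` allocated on link `l` to stream `s`. -/
abbrev Action (𝕜 : Type) (L S M : ℕ) : Type :=
  ℝ × (Fin M → 𝕜) × (Fin L → ℝ) × (Fin L → Fin S → ℝ)

section projections

variable {𝕜 : Type} {N L S M : ℕ}

/-- energy channels -/
def State.h (x : State 𝕜 N L S M) : Fin N → Fin M → 𝕜 := x.1

/-- data channels -/
def State.g (x : State 𝕜 N L S M) : Fin L → 𝕜 := x.2.1

/-- arrivals -/
def State.A (x : State 𝕜 N L S M) : Fin N → Fin S → ℝ := x.2.2

/-- EAP transmission power -/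
def Action.pAP (a : Action 𝕜 L S M) : ℝ := a.1

/-- beamforming vector -/
def Action.w (a : Action 𝕜 L S M) : Fin M → 𝕜 := a.2.1

/-- link powers -/
def Action.p (a : Action 𝕜 L S M) : Fin L → ℝ := a.2.2.1

/-- rates allocated to the streams on the links -/
def Action.c (a : Action 𝕜 L S M) : Fin L → Fin S → ℝ := a.2.2.2

/-- The power `Q_n = p_AP |w h_nᵀ|²` received by node `n`. -/
def received [RCLike 𝕜] (x : State 𝕜 N L S M) (a : Action 𝕜 L S M) (n : Fin N) : ℝ :=
  Action.pAP a * ‖∑ m, Action.w a m * State.h x n m‖ ^ 2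

end projections

variable {𝕜 : Type} [RCLike 𝕜] {N L S M : ℕ}

/-- outgoing links of a node -/
def outLinks (net : WPCN 𝕜 N L S M) (n : Fin N) : Finset (Fin L) :=
  Finset.univ.filter fun l => net.T l = n

/-- ingoing links of a node -/
def inLinks (net : WPCN 𝕜 N L S M) (n : Fin N) : Finset (Fin L) :=
  Finset.univ.filter fun l => net.R l = n

/-- The decisions available in a given state. -/
structure Feasible (net : WPCN 𝕜 N L S M) (x : State 𝕜 N L S M) (a : Action 𝕜 L S M) :
    Prop where
  pAP_mem : Action.pAP a ∈ Set.Icc 0 net.PAPm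
  w_unit : ∑ m, ‖Action.w a m‖ ^ 2 = 1
  p_mem : Action.p a ∈ net.powerSet
  c_nonneg : ∀ l s, 0 ≤ Action.c a l s
  c_le_cap : ∀ l, ∑ s, Action.c a l s ≤ net.cap l (Action.p a) (State.g x)

/-- The common law of the slot states: arrivals are bounded, nonnegative and occur only at the
source of their stream; the energy channels have finite mean energy. -/
structure IsStateLaw (net : WPCN 𝕜 N L S M) (μ : Measure (State 𝕜 N L S M)) : Prop where
  prob : IsProbabilityMeasure μ
  arrivals_bounded : ∃ Am : ℝ, ∀ᵐ x ∂μ, ∀ n s, State.A x n s ∈ Set.Icc 0 Am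
  arrivals_source : ∀ᵐ x ∂μ, ∀ n s, n ≠ net.src s → State.A x n s = 0
  channel_energy : ∀ n m, Integrable (fun x => ‖State.h x n m‖ ^ 2) μ

/-- The arrival rate `λ_n^s` of stream `s` at node `n`. -/
noncomputable def arrivalRate (μ : Measure (State 𝕜 N L S M)) (n : Fin N) (s : Fin S) : ℝ :=
  ∫ x, State.A x n s ∂μ

/-- A control policy, together with the i.i.d. slot states with law `μ` that it acts on, as a
process on a probability space.  It may be randomized, nonstationary and history dependent, but
not anticipating: the state of a slot is independent of all earlier states and decisions. -/
structure Policy (net : WPCN 𝕜 N L S M) (μ : Measure (State 𝕜 N L S M)) where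
  Ω : Type
  [mΩ : MeasurableSpace Ω]
  P : Measure Ω
  [prob : IsProbabilityMeasure P]
  /-- state of a slot -/
  X : ℕ → Ω → State 𝕜 N L S M
  /-- decision of a slot -/
  act : ℕ → Ω → Action 𝕜 L S M
  X_measurable : ∀ t, Measurable (X t)
  act_measurable : ∀ t, Measurable (act t)
  X_law : ∀ t, P.map (X t) = μ
  X_indep : ∀ t, IndepFun (fun ω (i : Fin t) => (X i ω, act i ω)) (X t) P
  feasible : ∀ t, ∀ᵐ ω ∂P, net.Feasible (X t ω) (act t ω)

attribute [instance] Policy.mΩ Policy.prob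

namespace Policy

variable {net : WPCN 𝕜 N L S M} {μ : Measure (State 𝕜 N L S M)}

/-- The backlog `U_n^s(t)` of the queue of stream `s` at node `n`.  Data that reach the
destination of their stream leave the network, so there is no queue there. -/
noncomputable def backlog (π : Policy net μ) : ℕ → π.Ω → Fin N → Fin S → ℝ
  | 0, _, n, s => if n = net.dst s then 0 else net.U0 n s
  | t + 1, ω, n, s =>
      if n = net.dst s then 0 else
        max (π.backlog t ω n s - ∑ l ∈ net.outLinks n, Action.c (π.act t ω) l s) 0
          + ∑ l ∈ net.inLinks n, Action.c (π.act t ω) l s + State.A (π.X t ω) n s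

/-- `𝔼 p_AP(t)` -/
noncomputable def meanEAP (π : Policy net μ) (t : ℕ) : ℝ :=
  ∫ ω, Action.pAP (π.act t ω) ∂π.P

/-- `𝔼 p_l(t)` -/
noncomputable def meanPower (π : Policy net μ) (t : ℕ) (l : Fin L) : ℝ :=
  ∫ ω, Action.p (π.act t ω) l ∂π.P

/-- `𝔼 C_l^s(t)` -/
noncomputable def meanRate (π : Policy net μ) (t : ℕ) (l : Fin L) (s : Fin S) : ℝ :=
  ∫ ω, Action.c (π.act t ω) l s ∂π.P

/-- `𝔼 Q_n(t)` -/
noncomputable def meanReceived (π : Policy net μ) (t : ℕ) (n : Fin N) : ℝ :=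
  ∫ ω, received (π.X t ω) (π.act t ω) n ∂π.P

/-- `𝔼 U_n^s(t)` -/
noncomputable def meanBacklog (π : Policy net μ) (t : ℕ) (n : Fin N) (s : Fin S) : ℝ :=
  ∫ ω, π.backlog t ω n s ∂π.P

/-- Stability: the limsup of the time averages of the expected total backlog is finite. -/
def IsStable (π : Policy net μ) : Prop :=
  IsBoundedUnder (· ≤ ·) atTop fun T : ℕ =>
    (∑ t ∈ Finset.range T, ∑ n, ∑ s, π.meanBacklog t n s) / T

/-- The average power constraint: in the long run, the mean power that a node spends does not
exceed the mean power that it receives. -/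
def AvgPowerConstraint (π : Policy net μ) : Prop :=
  ∀ n, limsup (fun T : ℕ =>
    (∑ t ∈ Finset.range T, ((∑ l ∈ net.outLinks n, π.meanPower t l) - π.meanReceived t n)) / T)
      atTop ≤ 0

/-- The average power of the EAP. -/
noncomputable def avgEAP (π : Policy net μ) : ℝ :=
  limsup (fun T : ℕ => (∑ t ∈ Finset.range T, π.meanEAP t) / T) atTop

/-- Stationary randomized policies: for one and the same Markov kernel `κ` and every slot `t`,
`κ (X t)` is the conditional law of the decision given the current state `X t` and all earlier
states and decisions. -/
def IsStationary (π : Policy net μ) : Prop :=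
  ∃ κ : Kernel (State 𝕜 N L S M) (Action 𝕜 L S M), IsMarkovKernel κ ∧ ∀ t,
    π.P.map (fun ω => (((fun i : Fin t => (π.X i ω, π.act i ω)), π.X t ω), π.act t ω)) =
      (π.P.map (fun ω => ((fun i : Fin t => (π.X i ω, π.act i ω)), π.X t ω))) ⊗ₘ
        (κ.comap Prod.snd measurable_snd)

end Policy

/-- The arrival rates belong to the capacity region: some policy stabilizes the arrivals under
the average power constraint. -/
def InCapacityRegion (net : WPCN 𝕜 N L S M) (μ : Measure (State 𝕜 N L S M)) : Prop :=
  ∃ π : Policy net μ, π.IsStable ∧ π.AvgPowerConstraint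

/-- The minimum power `P*_AP` required for stability: the infimum of the average EAP power over
all policies that stabilize the network under the average power constraint. -/
noncomputable def minPower (net : WPCN 𝕜 N L S M) (μ : Measure (State 𝕜 N L S M)) : ℝ :=
  sInf {P | ∃ π : Policy net μ, π.IsStable ∧ π.AvgPowerConstraint ∧ π.avgEAP = P}

end WPCN

/-! The conclusion only concerns the joint law of state and decision in one slot. Time averages of
such laws along a policy keep the state marginal `μ` and the feasibility of the decision, and the
mean excess EAP power, queue drifts and power deficits (`cost`) are affine in the law.

For a stable policy whose EAP power is close to the infimum, the summed drift of a queue up to `T`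
is at most its mean backlog at `T`. Stability makes this backlog at most `ε * T` for arbitrarily
large `T`, while the power averages are nearly admissible for all large `T`. So for every `ε` some
joint law has all its costs at most `ε` (`Policy.exists_jointLaw_integral_cost_le`).

The passage to `ε = 0` is a compactness argument for randomized decision rules
(`Kernel.exists_integral_le_zero`). Feasible decisions lie in a fixed compact ball and form closed
sets, by upper semicontinuity of the capacities. Rules with costs at most `1 / (n + 1)` form nested
sets closed under midpoints. Embedding the rules into an `L²` space by their moments and choosing
elements of nearly minimal norm gives a Cauchy sequence by the parallelogram law. A subsequence of
the moments converges almost everywhere, so the rules converge weakly at almost every state, and the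
weak limit inherits support and costs.

The limit law has mean EAP power at most the infimum. Since more EAP power never reduces the
received powers, it can be raised to equality (`IsJointLaw.exists_integral_pAP_eq`). Independent
draws from the resulting law form the stationary policy (`exists_stationary_policy`). -/

/-! ### Elements of nearly minimal norm in nested midpoint-closed sets. -/

/-- Nested, bounded, nonempty sets of a Hilbert space that are closed under midpoints have a
Cauchy sequence of selections. -/
theorem exists_cauchySeq_mem_of_midpoint {E : Type*} [NormedAddCommGroup E] [InnerProductSpace ℝ E]
    (S : ℕ → Set E) (anti : Antitone S) (ne : ∀ n, (S n).Nonempty)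
    (mid : ∀ n, ∀ x ∈ S n, ∀ y ∈ S n, (1 / 2 : ℝ) • (x + y) ∈ S n) (R : ℝ)
    (bdd : ∀ x ∈ S 0, ‖x‖ ≤ R) : ∃ x : ℕ → E, (∀ n, x n ∈ S n) ∧ CauchySeq x := by
  have sub (n : ℕ) : S n ⊆ S 0 := anti (Nat.zero_le n)
  have bdd2 (n : ℕ) : ∀ x ∈ S n, ‖x‖ ^ 2 ≤ R ^ 2 := fun x hx =>
    pow_le_pow_left₀ (norm_nonneg x) (bdd x (sub n hx)) 2
  set d : ℕ → ℝ := fun n => sInf ((fun x => ‖x‖ ^ 2) '' S n) with hd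
  have below (n : ℕ) : BddBelow ((fun x : E => ‖x‖ ^ 2) '' S n) :=
    ⟨0, by rintro _ ⟨x, -, rfl⟩; positivity⟩
  have d_le (n : ℕ) (x : E) (hx : x ∈ S n) : d n ≤ ‖x‖ ^ 2 := csInf_le (below n) ⟨x, hx, rfl⟩
  have d_mono : Monotone d := fun m n hmn =>
    csInf_le_csInf (below m) ((ne n).image _) (Set.image_mono (anti hmn))
  have d_bdd : BddAbove (Set.range d) := by
    refine ⟨R ^ 2, ?_⟩
    rintro _ ⟨n, rfl⟩
    obtain ⟨x, hx⟩ := ne n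
    exact (d_le n x hx).trans (bdd2 n x hx)
  have d_lim := tendsto_atTop_ciSup d_mono d_bdd
  have ex (n : ℕ) : ∃ x ∈ S n, ‖x‖ ^ 2 < d n + 1 / ((n : ℝ) + 1) := by
    obtain ⟨_, ⟨x, hx, rfl⟩, hlt⟩ := exists_lt_of_csInf_lt ((ne n).image fun x => ‖x‖ ^ 2)
      (lt_add_of_pos_right (d n) (Nat.one_div_pos_of_nat (n := n) (α := ℝ)))
    exact ⟨x, hx, hlt⟩
  choose x hx hlt using ex
  refine ⟨x, hx, ?_⟩
  -- For `n ≤ m` the midpoint of `x n` and `x m` lies in `S n`, so its squared norm is at least `d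
  -- n`. The parallelogram law then bounds `‖x n - x m‖ ^ 2` by the radicand.
  set b : ℕ → ℝ := fun n => √(2 * ((⨆ i, d i) - d n) + 4 * (1 / ((n : ℝ) + 1))) with hb
  have b_lim : Tendsto b atTop (nhds 0) := by
    have h : Tendsto (fun n : ℕ => 2 * ((⨆ i, d i) - d n) + 4 * (1 / ((n : ℝ) + 1))) atTop
        (nhds (2 * ((⨆ i, d i) - ⨆ i, d i) + 4 * 0)) :=
      ((tendsto_const_nhds.sub d_lim).const_mul 2).add
        (tendsto_one_div_add_atTop_nhds_zero_nat.const_mul 4)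
    have h' := (Real.continuous_sqrt.tendsto _).comp h
    simp only [sub_self, mul_zero, add_zero, Real.sqrt_zero] at h'
    exact h'
  have key (n m : ℕ) (hnm : n ≤ m) : dist (x n) (x m) ≤ b n := by
    rw [dist_eq_norm]
    apply Real.le_sqrt_of_sq_le
    have par := parallelogram_law_with_norm ℝ (x n) (x m)
    have hm := d_le n _ (mid n _ (hx n) _ (anti hnm (hx m)))
    rw [norm_smul, mul_pow] at hm
    norm_num at hm
    have h1 : 1 / ((m : ℝ) + 1) ≤ 1 / ((n : ℝ) + 1) := Nat.one_div_le_one_div hnm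
    have h2 : d m ≤ ⨆ i, d i := le_ciSup d_bdd m
    have h3 := hlt n
    have h4 := hlt m
    nlinarith
  exact cauchySeq_of_le_tendsto_0' b key b_lim

/-! ### Almost everywhere weakly convergent selections of Markov kernels, via moments in `L²`. -/

namespace ProbabilityTheory.Kernel

variable {X K : Type*} [MeasurableSpace X] [MeasurableSpace K]

/-- The equal mixture of two kernels. -/
noncomputable def midpoint (κ η : Kernel X K) : Kernel X K where
  toFun x := (2⁻¹ : ENNReal) • (κ x + η x)
  measurable' := Measure.measurable_of_measurable_coe _ fun s hs => by
    simpa [mul_add] using ((κ.measurable_coe hs).add (η.measurable_coe hs)).const_mul 2⁻¹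

theorem midpoint_apply (κ η : Kernel X K) (x : X) :
    midpoint κ η x = (2⁻¹ : ENNReal) • (κ x + η x) := rfl

instance (κ η : Kernel X K) [IsMarkovKernel κ] [IsMarkovKernel η] :
    IsMarkovKernel (midpoint κ η) where
  isProbabilityMeasure x := ⟨by
    simp [midpoint_apply, ENNReal.inv_two_add_inv_two]⟩

theorem integral_midpoint (κ η : Kernel X K) (x : X) {f : K → ℝ} (hκ : Integrable f (κ x))
    (hη : Integrable f (η x)) :
    ∫ a, f a ∂midpoint κ η x = (1 / 2 : ℝ) * (∫ a, f a ∂κ x + ∫ a, f a ∂η x) := by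
  rw [midpoint_apply, integral_smul_measure, integral_add_measure hκ hη]
  simp

variable [MetricSpace K] [CompactSpace K]

theorem integrable_continuousMap [BorelSpace K] (m : Measure K) [IsFiniteMeasure m] (f : C(K, ℝ)) :
    Integrable f m :=
  Integrable.of_bound f.continuous.aestronglyMeasurable ‖f‖ (ae_of_all _ f.norm_coe_le_norm)

/-- The integrals of a dense sequence of continuous functions, normalized, against a kernel. -/
noncomputable def moments (κ : Kernel X K) (z : X × ℕ) : ℝ :=
  (1 + ‖TopologicalSpace.denseSeq C(K, ℝ) z.2‖)⁻¹ *
    ∫ a, TopologicalSpace.denseSeq C(K, ℝ) z.2 a ∂κ z.1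

theorem measurable_moments [BorelSpace K] (κ : Kernel X K) : Measurable κ.moments := by
  refine measurable_from_prod_countable_left fun j => ?_
  exact ((TopologicalSpace.denseSeq C(K, ℝ) j).continuous.stronglyMeasurable.integral_kernel
    (κ := κ)).measurable.const_mul (1 + ‖TopologicalSpace.denseSeq C(K, ℝ) j‖)⁻¹

theorem norm_moments_le (κ : Kernel X K) [IsMarkovKernel κ] (z : X × ℕ) : ‖κ.moments z‖ ≤ 1 := by
  set f := TopologicalSpace.denseSeq C(K, ℝ) z.2 with hf
  have h : ‖∫ a, f a ∂κ z.1‖ ≤ ‖f‖ := by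
    simpa using norm_integral_le_of_norm_le_const (μ := κ z.1) (ae_of_all _ f.norm_coe_le_norm)
  have h0 : 0 < 1 + ‖f‖ := by positivity
  rw [moments, norm_mul, norm_inv, Real.norm_of_nonneg h0.le, inv_mul_le_iff₀ h0]
  linarith

variable [BorelSpace K]

theorem memLp_moments (κ : Kernel X K) [IsMarkovKernel κ] (m : Measure (X × ℕ))
    [IsFiniteMeasure m] : MemLp κ.moments 2 m :=
  MemLp.of_bound κ.measurable_moments.aestronglyMeasurable 1 (ae_of_all _ κ.norm_moments_le)

/-- This carries closure under midpoints from sets of kernels to their images in `L²`. -/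
theorem moments_midpoint (κ η : Kernel X K) [IsMarkovKernel κ] [IsMarkovKernel η] :
    (midpoint κ η).moments = (1 / 2 : ℝ) • (κ.moments + η.moments) := by
  ext z
  simp only [moments, Pi.smul_apply, Pi.add_apply, smul_eq_mul]
  rw [integral_midpoint _ _ _ (integrable_continuousMap _ _) (integrable_continuousMap _ _)]
  ring

/-- From nested nonempty sets of Markov kernels that are closed under midpoints one can select
a sequence of kernels that converges weakly at almost every point. -/
theorem exists_seq_tendsto_ae (μ : Measure X) [IsFiniteMeasure μ] (C : ℕ → Set (Kernel X K))
    (markov : ∀ κ ∈ C 0, IsMarkovKernel κ) (anti : Antitone C) (ne : ∀ n, (C n).Nonempty)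
    (mid : ∀ n, ∀ κ ∈ C n, ∀ η ∈ C n, midpoint κ η ∈ C n) :
    ∃ κ : ℕ → Kernel X K, (∀ n, κ n ∈ C n) ∧
      ∀ᵐ x ∂μ, ∀ f : C(K, ℝ), ∃ y, Tendsto (fun n => ∫ a, f a ∂κ n x) atTop (nhds y) := by
  -- A finite measure with the null sets of counting measure: bounded moments are then in `L²`, and
  -- a property that holds almost everywhere holds at every index.
  let ν : Measure ℕ := Measure.count.toFinite
  let m : Measure (X × ℕ) := μ.prod ν
  have mk {n : ℕ} {κ : Kernel X K} (h : κ ∈ C n) : IsMarkovKernel κ :=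
    markov κ (anti (Nat.zero_le n) h)
  let S : ℕ → Set (Lp ℝ 2 m) := fun n => {g | ∃ κ ∈ C n, g =ᵐ[m] κ.moments}
  have hcauchy : ∃ g : ℕ → Lp ℝ 2 m, (∀ n, g n ∈ S n) ∧ CauchySeq g := by
    refine exists_cauchySeq_mem_of_midpoint S ?_ ?_ ?_ (measureUnivNNReal m ^ (2 : ℝ)⁻¹) ?_
    · rintro i j hij g ⟨κ, hκ, h⟩
      exact ⟨κ, anti hij hκ, h⟩
    · intro n
      obtain ⟨κ, hκ⟩ := ne n
      have := mk hκ
      exact ⟨(κ.memLp_moments m).toLp, κ, hκ, MemLp.coeFn_toLp _⟩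
    · rintro n g ⟨κ, hκ, hg⟩ g' ⟨η, hη, hg'⟩
      have := mk hκ
      have := mk hη
      refine ⟨midpoint κ η, mid n κ hκ η hη, ?_⟩
      rw [moments_midpoint]
      filter_upwards [Lp.coeFn_smul (1 / 2 : ℝ) (g + g'), Lp.coeFn_add g g', hg, hg']
        with z h1 h2 h3 h4
      rw [h1, Pi.smul_apply, h2, Pi.add_apply, h3, h4]
      rfl
    · rintro g ⟨κ, hκ, hg⟩
      have := mk hκ
      have h := Lp.norm_le_of_ae_bound (f := g) (C := 1) zero_le_one (by
        filter_upwards [hg] with z hz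
        rw [hz]
        exact κ.norm_moments_le z)
      simpa using h
  obtain ⟨g, hgS, hg⟩ := hcauchy
  choose κ hκ hgκ using hgS
  obtain ⟨g', hlim⟩ := cauchySeq_tendsto_of_complete hg
  -- Convergence in `L²` gives almost everywhere convergence only along a subsequence. This is
  -- harmless, because `n ≤ ns n` and the sets `C n` decrease.
  obtain ⟨ns, hns, hae⟩ := (tendstoInMeasure_of_tendsto_Lp hlim).exists_seq_tendsto_ae
  have hmarkov (n : ℕ) := mk (hκ n)
  refine ⟨fun n => κ (ns n), fun n => anti hns.le_apply (hκ (ns n)), ?_⟩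
  have hae2 : ∀ᵐ z ∂m, Tendsto (fun n => (κ (ns n)).moments z) atTop (nhds (g' z)) := by
    filter_upwards [hae, ae_all_iff.2 hgκ] with z hz h
    simpa only [h] using hz
  have hae3 := Measure.ae_ae_of_ae_prod hae2
  filter_upwards [hae3] with x hx f
  have hx' (j : ℕ) : Tendsto (fun n => (κ (ns n)).moments (x, j)) atTop (nhds (g' (x, j))) := by
    have : ∀ᵐ j ∂(Measure.count : Measure ℕ),
        Tendsto (fun n => (κ (ns n)).moments (x, j)) atTop (nhds (g' (x, j))) := by
      rw [← ae_toFinite]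
      exact hx
    exact (Measure.ae_count_iff.1 this) j
  -- Convergence is known for a dense sequence of test functions. An `ε / 3` argument extends it to
  -- every `f`, as probability measures do not increase the uniform distance.
  refine cauchySeq_tendsto_of_complete ?_
  rw [Metric.cauchySeq_iff']
  intro ε hε
  obtain ⟨j, hj⟩ := (TopologicalSpace.denseRange_denseSeq C(K, ℝ)).exists_dist_lt f
    (show 0 < ε / 3 by positivity)
  set u := TopologicalSpace.denseSeq C(K, ℝ) j with hu
  have hc : CauchySeq fun n => ∫ a, u a ∂κ (ns n) x := by
    have h := ((hx' j).const_mul (1 + ‖u‖)).cauchySeq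
    have heq : (fun n => ∫ a, u a ∂κ (ns n) x) =
        fun n => (1 + ‖u‖) * (κ (ns n)).moments (x, j) := by
      ext n
      exact (mul_inv_cancel_left₀ (show 1 + ‖u‖ ≠ 0 by positivity) _).symm
    rwa [heq]
  have hd (n : ℕ) : dist (∫ a, f a ∂κ (ns n) x) (∫ a, u a ∂κ (ns n) x) ≤ ε / 3 := by
    rw [dist_eq_norm, ← integral_sub (integrable_continuousMap _ _) (integrable_continuousMap _ _)]
    have := norm_integral_le_of_norm_le_const (μ := κ (ns n) x) (f := fun a => f a - u a)
      (C := ε / 3) (ae_of_all _ fun a => by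
        rw [← dist_eq_norm]
        exact (ContinuousMap.dist_apply_le_dist a).trans hj.le)
    simpa using this
  obtain ⟨N, hN⟩ := Metric.cauchySeq_iff'.1 hc (ε / 3) (by positivity)
  refine ⟨N, fun n hn => ?_⟩
  have h1 := hd n
  have h2 := hd N
  have h3 := hN n hn
  rw [dist_comm] at h2
  calc _ ≤ _ := dist_triangle4 _ (∫ a, u a ∂κ (ns n) x) (∫ a, u a ∂κ (ns N) x) _
    _ < ε := by linarith

end ProbabilityTheory.Kernel

/-! ### Weak limits of kernels and compactness of randomized decision rules. -/

namespace ProbabilityTheory.Kernel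

variable {X K : Type*} [MeasurableSpace X] [MeasurableSpace K] [MetricSpace K] [CompactSpace K]
  [BorelSpace K]

/-- The probability measure that a Markov kernel assigns to a point. -/
def toProbabilityMeasure (κ : Kernel X K) [IsMarkovKernel κ] (x : X) : ProbabilityMeasure K :=
  ⟨κ x, inferInstance⟩

omit [MetricSpace K] [CompactSpace K] [BorelSpace K] in
theorem coe_toProbabilityMeasure (κ : Kernel X K) [IsMarkovKernel κ] (x : X) :
    (κ.toProbabilityMeasure x : Measure K) = κ x := rfl

/-- In a compact space, a sequence of probability measures converges weakly as soon as all
integrals of continuous functions converge. -/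
theorem exists_tendsto_of_forall_integral (p : ℕ → ProbabilityMeasure K)
    (h : ∀ f : C(K, ℝ), ∃ y, Tendsto (fun n => ∫ a, f a ∂(p n : Measure K)) atTop (nhds y)) :
    ∃ q, Tendsto p atTop (nhds q) := by
  obtain ⟨q, hq⟩ := exists_clusterPt_of_compactSpace (Filter.map p atTop)
  refine ⟨q, ProbabilityMeasure.tendsto_iff_forall_integral_tendsto.2 fun f => ?_⟩
  obtain ⟨y, hy⟩ := h f.toContinuousMap
  have hc := (ProbabilityMeasure.continuous_integral_boundedContinuousFunction f).tendsto q
  have h1 : ClusterPt (∫ a, f a ∂(q : Measure K))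
      (Filter.map (fun n => ∫ a, f a ∂(p n : Measure K)) atTop) := by
    have := hq.map (ProbabilityMeasure.continuous_integral_boundedContinuousFunction f).continuousAt
      tendsto_map
    rwa [Filter.map_map] at this
  -- Every integral has a limit, which must agree with its value at the cluster point `q`. Hence the
  -- whole sequence converges to `q`.
  have h2 : ClusterPt (∫ a, f a ∂(q : Measure K)) (nhds y) := h1.mono hy
  have := eq_of_nhds_neBot h2
  rw [this]
  exact hy

omit [CompactSpace K] in
/-- A pointwise weak limit of kernels is a kernel. -/
theorem measurable_of_tendsto (κ : ℕ → Kernel X K) [∀ n, IsMarkovKernel (κ n)]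
    (q : X → ProbabilityMeasure K)
    (h : ∀ x, Tendsto (fun n => (κ n).toProbabilityMeasure x) atTop (nhds (q x))) :
    Measurable fun x => (q x : Measure K) := by
  refine Measurable.measure_of_isPiSystem_of_isProbabilityMeasure
    (BorelSpace.measurable_eq.trans borel_eq_generateFrom_isClosed) isPiSystem_isClosed ?_
  intro F hF
  -- The measure of a closed set is the limit of integrals of continuous outer approximations, each
  -- of which is a limit of integrals against the kernels `κ k`.
  refine measurable_of_tendsto_metrizable (f := fun n x => ∫⁻ a, hF.apprSeq n a ∂(q x : Measure K))
    (fun n => ?_) ?_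
  · refine measurable_of_tendsto_metrizable (f := fun k x => ∫⁻ a, hF.apprSeq n a ∂(κ k x))
      (fun k => ?_) ?_
    · exact (Measurable.lintegral_kernel (κ := κ k)
        (by exact ((hF.apprSeq n).continuous.measurable).coe_nnreal_ennreal))
    · rw [tendsto_pi_nhds]
      exact fun x => ProbabilityMeasure.tendsto_iff_forall_lintegral_tendsto.1 (h x) _
  · rw [tendsto_pi_nhds]
    exact fun x => HasOuterApproxClosed.tendsto_lintegral_apprSeq hF (q x : Measure K)

/-- On a measurable null set containing the exceptional points the kernels are replaced by a
constant Dirac kernel. The limit then exists everywhere, which makes it measurable. -/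
theorem exists_kernel_tendsto [Nonempty K] (μ : Measure X) (κ : ℕ → Kernel X K)
    [∀ n, IsMarkovKernel (κ n)]
    (h : ∀ᵐ x ∂μ, ∀ f : C(K, ℝ), ∃ y, Tendsto (fun n => ∫ a, f a ∂κ n x) atTop (nhds y)) :
    ∃ (η : Kernel X K) (_ : IsMarkovKernel η), ∀ᵐ x ∂μ,
      Tendsto (fun n => (κ n).toProbabilityMeasure x) atTop (nhds (η.toProbabilityMeasure x)) := by
  classical
  obtain ⟨B, hsub, hB, hμB⟩ := exists_measurable_superset_of_null (ae_iff.1 h)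
  let δ : Kernel X K := Kernel.const X (Measure.dirac (Classical.arbitrary K))
  let κ' : ℕ → Kernel X K := fun n => Kernel.piecewise hB δ (κ n)
  have hδ : IsMarkovKernel δ := by dsimp only [δ]; infer_instance
  have hκ' (n : ℕ) : IsMarkovKernel (κ' n) := by dsimp only [κ']; infer_instance
  have hB' (x : X) (hx : x ∉ B) (n : ℕ) : κ' n x = κ n x := by simp [κ', piecewise_apply, hx]
  have ex (x : X) : ∃ q, Tendsto (fun n => (κ' n).toProbabilityMeasure x) atTop (nhds q) := by
    by_cases hx : x ∈ B
    · have : (fun n => (κ' n).toProbabilityMeasure x) = fun _ => δ.toProbabilityMeasure x := by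
        ext n : 1
        apply Subtype.ext
        simp [toProbabilityMeasure, κ', piecewise_apply, hx]
      rw [this]
      exact ⟨_, tendsto_const_nhds⟩
    · refine exists_tendsto_of_forall_integral _ fun f => ?_
      simp only [coe_toProbabilityMeasure, hB' x hx]
      by_contra hcon
      exact hx (hsub fun hall => hcon (hall f))
  choose q hq using ex
  let η : Kernel X K := ⟨fun x => q x, measurable_of_tendsto κ' q hq⟩
  have hη : IsMarkovKernel η := ⟨fun x => (inferInstance : IsProbabilityMeasure (q x : Measure K))⟩
  refine ⟨η, hη, ?_⟩
  have : ∀ᵐ x ∂μ, x ∉ B := by rw [ae_iff]; simpa using hμB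
  filter_upwards [this] with x hx
  have h1 : (fun n => (κ n).toProbabilityMeasure x) = fun n => (κ' n).toProbabilityMeasure x := by
    ext n : 1
    exact Subtype.ext (hB' x hx n).symm
  rw [h1]
  exact hq x

/-- Compactness of randomized decision rules: if the expected costs of a family can be made
arbitrarily small by rules that are supported in the closed sets `Γ x`, they can be made
nonpositive. -/
theorem exists_integral_le_zero [Nonempty K] (μ : Measure X) [IsFiniteMeasure μ] (Γ : X → Set K)
    (hΓ : ∀ x, IsClosed (Γ x)) {ι : Type*} (φ : ι → X → K → ℝ) (b : ι → X → ℝ)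
    (hb : ∀ i, Integrable (b i) μ) (hφb : ∀ i x a, |φ i x a| ≤ b i x)
    (hφc : ∀ i x, Continuous (φ i x)) (hφm : ∀ i, Measurable fun z : X × K => φ i z.1 z.2)
    (h : ∀ ε > 0, ∃ κ : Kernel X K, IsMarkovKernel κ ∧ (∀ᵐ x ∂μ, κ x (Γ x)ᶜ = 0) ∧
      ∀ i, ∫ x, ∫ a, φ i x a ∂κ x ∂μ ≤ ε) :
    ∃ κ : Kernel X K, IsMarkovKernel κ ∧ (∀ᵐ x ∂μ, κ x (Γ x)ᶜ = 0) ∧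
      ∀ i, ∫ x, ∫ a, φ i x a ∂κ x ∂μ ≤ 0 := by
  have int_in (i : ι) (x : X) (m : Measure K) [IsFiniteMeasure m] : Integrable (φ i x) m :=
    Integrable.of_bound (hφc i x).aestronglyMeasurable (b i x) (ae_of_all _ (hφb i x))
  have bound (i : ι) (κ : Kernel X K) [IsMarkovKernel κ] (x : X) :
      ‖∫ a, φ i x a ∂κ x‖ ≤ b i x := by
    simpa using norm_integral_le_of_norm_le_const (μ := κ x) (f := φ i x) (ae_of_all _ (hφb i x))
  have meas (i : ι) (κ : Kernel X K) [IsMarkovKernel κ] :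
      AEStronglyMeasurable (fun x => ∫ a, φ i x a ∂κ x) μ :=
    ((hφm i).stronglyMeasurable.integral_kernel_prod_right' (κ := κ)).aestronglyMeasurable
  have int_out (i : ι) (κ : Kernel X K) [IsMarkovKernel κ] :
      Integrable (fun x => ∫ a, φ i x a ∂κ x) μ :=
    (hb i).mono' (meas i κ) (ae_of_all _ (bound i κ))
  let C : ℕ → Set (Kernel X K) := fun n => {κ | IsMarkovKernel κ ∧ (∀ᵐ x ∂μ, κ x (Γ x)ᶜ = 0) ∧
      ∀ i, ∫ x, ∫ a, φ i x a ∂κ x ∂μ ≤ 1 / ((n : ℝ) + 1)}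
  obtain ⟨κ, hκ, hlim⟩ := exists_seq_tendsto_ae μ C (fun κ hκ => hκ.1)
    (fun m n hmn κ hκ => ⟨hκ.1, hκ.2.1, fun i => (hκ.2.2 i).trans (Nat.one_div_le_one_div hmn)⟩)
    (fun n => h _ Nat.one_div_pos_of_nat) (by
      rintro n κ ⟨hκ, hκΓ, hκφ⟩ η ⟨hη, hηΓ, hηφ⟩
      refine ⟨inferInstance, ?_, fun i => ?_⟩
      · filter_upwards [hκΓ, hηΓ] with x h1 h2
        simp [midpoint_apply, h1, h2]
      · simp_rw [integral_midpoint _ _ _ (int_in i _ _) (int_in i _ _)]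
        rw [integral_const_mul, integral_add (int_out i κ) (int_out i η)]
        linarith [hκφ i, hηφ i])
  have hmarkov (n : ℕ) : IsMarkovKernel (κ n) := (hκ n).1
  obtain ⟨η, hη, hηlim⟩ := exists_kernel_tendsto μ κ hlim
  refine ⟨η, hη, ?_, fun i => ?_⟩
  · filter_upwards [hηlim, ae_all_iff.2 fun n => (hκ n).2.1] with x hx hx0
    -- Portmanteau: the open complement of `Γ x` has measure zero under every `κ n x`, hence under
    -- the limit.
    have := ProbabilityMeasure.le_liminf_measure_open_of_tendsto hx (hΓ x).isOpen_compl
    simpa [coe_toProbabilityMeasure, hx0] using this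
  · have ht : Tendsto (fun n => ∫ x, ∫ a, φ i x a ∂κ n x ∂μ) atTop
        (nhds (∫ x, ∫ a, φ i x a ∂η x ∂μ)) := by
      -- The weak convergence is at fixed `x`, so continuity of the costs in the decision suffices.
      refine tendsto_integral_of_dominated_convergence (b i) (fun n => meas i (κ n)) (hb i)
        (fun n => ae_of_all _ (bound i (κ n))) ?_
      filter_upwards [hηlim] with x hx
      exact ProbabilityMeasure.tendsto_iff_forall_integral_tendsto.1 hx
        (BoundedContinuousFunction.mkOfCompact ⟨φ i x, hφc i x⟩)
    exact le_of_tendsto_of_tendsto' ht tendsto_one_div_add_atTop_nhds_zero_nat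
      fun n => (hκ n).2.2 i

end ProbabilityTheory.Kernel

/-! ### Stationary policies as independent draws from one joint law. -/

namespace WPCN

variable {𝕜 : Type} [RCLike 𝕜] {N L S M : ℕ}

/-- A joint law of state and feasible decision, with the prescribed law of the state, is the law
of all slots of some stationary policy. -/
theorem exists_stationary_policy (net : WPCN 𝕜 N L S M) (μ : Measure (State 𝕜 N L S M))
    (ρ : Measure (State 𝕜 N L S M × Action 𝕜 L S M)) [IsProbabilityMeasure ρ] (hρ : ρ.fst = μ)
    (feas : ∀ᵐ z ∂ρ, net.Feasible z.1 z.2) :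
    ∃ π : Policy net μ, π.IsStationary ∧
      ∀ t, π.P.map (fun ω => (π.X t ω, π.act t ω)) = ρ := by
  let P : Measure (ℕ → State 𝕜 N L S M × Action 𝕜 L S M) := Measure.infinitePi fun _ => ρ
  have law (t : ℕ) : P.map (fun ω => ω t) = ρ := Measure.infinitePi_map_eval (fun _ => ρ) t
  have past_meas (t : ℕ) : Measurable fun (ω : ℕ → State 𝕜 N L S M × Action 𝕜 L S M)
      (i : Fin t) => ω i := by fun_prop
  have indep (t : ℕ) : IndepFun (fun (ω : ℕ → State 𝕜 N L S M × Action 𝕜 L S M) (i : Fin t) => ω i)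
      (fun ω => ω t) P := by
    have h : iIndepFun (fun (i : ℕ) (ω : ℕ → State 𝕜 N L S M × Action 𝕜 L S M) => ω i) P :=
      iIndepFun_infinitePi (X := fun _ z => z) (fun _ => measurable_id)
    have h2 := h.indepFun_finset (Finset.range t) {t} (by simp) (fun i => measurable_pi_apply i)
    have hφ : Measurable fun (u : Finset.range t → State 𝕜 N L S M × Action 𝕜 L S M)
        (i : Fin t) => u ⟨i, Finset.mem_range.2 i.2⟩ := by fun_prop
    have hψ : Measurable fun u : ({t} : Finset ℕ) → State 𝕜 N L S M × Action 𝕜 L S M =>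
        u ⟨t, Finset.mem_singleton_self t⟩ := measurable_pi_apply _
    exact h2.comp hφ hψ
  have joint (t : ℕ) : P.map (fun ω => ((fun i : Fin t => ω i), ω t)) =
      (P.map fun ω (i : Fin t) => ω i).prod ρ := by
    rw [(indepFun_iff_map_prod_eq_prod_map_map (past_meas t).aemeasurable
      (measurable_pi_apply t).aemeasurable).1 (indep t), law]
  let π : Policy net μ :=
    { Ω := ℕ → State 𝕜 N L S M × Action 𝕜 L S M
      P := P
      X := fun t ω => (ω t).1
      act := fun t ω => (ω t).2
      X_measurable := fun t => by fun_prop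
      act_measurable := fun t => by fun_prop
      X_law := fun t => by
        rw [← hρ, Measure.fst, ← law t, Measure.map_map measurable_fst (measurable_pi_apply t)]
        rfl
      X_indep := fun t => (indep t).comp measurable_id measurable_fst
      feasible := fun t => by
        have h := feas
        rw [← law t] at h
        exact ae_of_ae_map (measurable_pi_apply t).aemeasurable h }
  -- The current pair is independent of the past, so the conditional law of the decision given state
  -- and past is the one given the state alone.
  refine ⟨π, ⟨ρ.condKernel, inferInstance, fun t => ?_⟩, law⟩
  have dis : μ ⊗ₘ ρ.condKernel = ρ := by rw [← hρ]; exact ρ.disintegrate ρ.condKernel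
  have hμ : IsProbabilityMeasure μ := by rw [← hρ]; infer_instance
  have : IsProbabilityMeasure (P.map fun ω (i : Fin t) => ω i) :=
    Measure.isProbabilityMeasure_map (past_meas t).aemeasurable
  have h1 : π.P.map (fun ω => ((fun i : Fin t => (π.X i ω, π.act i ω)), π.X t ω)) =
      (P.map fun ω (i : Fin t) => ω i).prod μ := by
    have : μ = ρ.map Prod.fst := hρ.symm
    conv_rhs => rw [this, ← Measure.map_id (μ := P.map fun ω (i : Fin t) => ω i)]
    rw [Measure.map_prod_map _ _ measurable_id measurable_fst, ← joint t,
      Measure.map_map (by fun_prop) (by fun_prop)]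
    rfl
  have h2 : π.P.map (fun ω => (((fun i : Fin t => (π.X i ω, π.act i ω)), π.X t ω), π.act t ω)) =
      ((P.map fun ω (i : Fin t) => ω i).prod ρ).map fun u => ((u.1, u.2.1), u.2.2) := by
    rw [← joint t, Measure.map_map (by fun_prop) (by fun_prop)]
    rfl
  rw [h1, h2]
  refine Measure.ext_of_lintegral _ fun f hf => ?_
  rw [lintegral_map hf (by fun_prop), lintegral_prod _ (by fun_prop),
    Measure.lintegral_compProd hf, lintegral_prod _ (by
      exact (Measurable.lintegral_kernel_prod_right'
        (κ := ρ.condKernel.comap Prod.snd measurable_snd) hf).aemeasurable)]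
  refine lintegral_congr fun u => ?_
  conv_lhs => rw [← dis]
  rw [Measure.lintegral_compProd (by fun_prop)]
  rfl

end WPCN

/-! ### Feasible decisions and joint laws: measurability, closedness, bounds, compactness. -/

namespace WPCN

variable {𝕜 : Type} [RCLike 𝕜] {N L S M : ℕ}

theorem measurable_received (n : Fin N) :
    Measurable fun z : State 𝕜 N L S M × Action 𝕜 L S M => received z.1 z.2 n := by
  unfold received Action.pAP Action.w State.h
  fun_prop

theorem continuous_received (x : State 𝕜 N L S M) (n : Fin N) :
    Continuous fun a : Action 𝕜 L S M => received x a n := by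
  unfold received Action.pAP Action.w State.h
  fun_prop

theorem measurableSet_feasible (net : WPCN 𝕜 N L S M) :
    MeasurableSet {z : State 𝕜 N L S M × Action 𝕜 L S M | net.Feasible z.1 z.2} := by
  have : {z : State 𝕜 N L S M × Action 𝕜 L S M | net.Feasible z.1 z.2} =
      {z | z.2.1 ∈ Set.Icc 0 net.PAPm} ∩ {z | ∑ m, ‖z.2.2.1 m‖ ^ 2 = 1} ∩
        {z | z.2.2.2.1 ∈ net.powerSet} ∩ (⋂ l, ⋂ s, {z | 0 ≤ z.2.2.2.2 l s}) ∩
        ⋂ l, {z | ∑ s, z.2.2.2.2 l s ≤ net.cap l z.2.2.2.1 z.1.2.1} := by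
    ext z
    simp only [Set.mem_inter_iff, Set.mem_iInter]
    exact ⟨fun h => ⟨⟨⟨⟨h.1, h.2⟩, h.3⟩, h.4⟩, h.5⟩, fun h => ⟨h.1.1.1.1, h.1.1.1.2, h.1.1.2,
      h.1.2, h.2⟩⟩
  rw [this]
  refine ((((?_ : MeasurableSet _).inter ?_).inter ?_).inter ?_).inter ?_
  · exact measurableSet_Icc.preimage (by fun_prop)
  · exact measurableSet_eq_fun (by fun_prop) (by fun_prop)
  · exact net.powerSet_closed.measurableSet.preimage (by fun_prop)
  · exact MeasurableSet.iInter fun l => MeasurableSet.iInter fun s =>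
      measurableSet_le (by fun_prop) (by fun_prop)
  · refine MeasurableSet.iInter fun l => measurableSet_le (by fun_prop) ?_
    exact (net.cap_measurable l).comp (f := fun z : State 𝕜 N L S M × Action 𝕜 L S M =>
      (z.2.2.2.1, z.1.2.1)) (by fun_prop)

/-- Only the capacity constraints need an argument: hypographs of upper semicontinuous functions on
a closed set are closed. As semicontinuity is available only on `powerSet`, each of these
constraints is paired with membership there. -/
theorem isClosed_feasible (net : WPCN 𝕜 N L S M) (x : State 𝕜 N L S M) :
    IsClosed {a | net.Feasible x a} := by
  have : {a : Action 𝕜 L S M | net.Feasible x a} =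
      {a | a.1 ∈ Set.Icc 0 net.PAPm} ∩ {a | ∑ m, ‖a.2.1 m‖ ^ 2 = 1} ∩
        (⋂ l, ⋂ s, {a | 0 ≤ a.2.2.2 l s}) ∩ ({a | a.2.2.1 ∈ net.powerSet} ∩
        ⋂ l, {a | a.2.2.1 ∈ net.powerSet ∧ ∑ s, a.2.2.2 l s ≤ net.cap l a.2.2.1 x.2.1}) := by
    ext a
    simp only [Set.mem_inter_iff, Set.mem_iInter]
    exact ⟨fun h => ⟨⟨⟨h.1, h.2⟩, h.4⟩, h.3, fun l => ⟨h.3, h.5 l⟩⟩,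
      fun h => ⟨h.1.1.1, h.1.1.2, h.2.1, h.1.2, fun l => (h.2.2 l).2⟩⟩
  rw [this]
  refine (((?_ : IsClosed _).inter ?_).inter ?_).inter (IsClosed.inter ?_ ?_)
  · exact isClosed_Icc.preimage (by fun_prop)
  · exact isClosed_eq (by fun_prop) (by fun_prop)
  · exact isClosed_iInter fun l => isClosed_iInter fun s => isClosed_le (by fun_prop) (by fun_prop)
  · exact net.powerSet_closed.preimage (by fun_prop)
  · refine isClosed_iInter fun l => isOpen_compl_iff.1 (isOpen_iff_mem_nhds.2 fun a ha => ?_)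
    have hp : Tendsto (fun a : Action 𝕜 L S M => a.2.2.1) (nhds a) (nhds a.2.2.1) :=
      Continuous.tendsto (by fun_prop) a
    have hc : Tendsto (fun a : Action 𝕜 L S M => ∑ s, a.2.2.2 l s) (nhds a)
        (nhds (∑ s, a.2.2.2 l s)) := Continuous.tendsto (by fun_prop) a
    by_cases hmem : a.2.2.1 ∈ net.powerSet
    · have hlt : net.cap l a.2.2.1 x.2.1 < ∑ s, a.2.2.2 l s := by
        by_contra hcon
        exact ha ⟨hmem, not_lt.1 hcon⟩
      obtain ⟨r, hr1, hr2⟩ := exists_between hlt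
      have h1 := hp.eventually (eventually_nhdsWithin_iff.1 (net.cap_usc l x.2.1 _ hmem r hr1))
      filter_upwards [h1, hc.eventually (lt_mem_nhds hr2)] with b hb1 hb2 hb
      exact absurd hb.2 (not_le.2 ((hb1 hb.1).trans hb2))
    · filter_upwards [hp.eventually (net.powerSet_closed.isOpen_compl.mem_nhds hmem)] with b hb hb'
      exact hb hb'.1

/-- All feasible decisions lie in a common ball. -/
theorem exists_norm_le_of_feasible (net : WPCN 𝕜 N L S M) :
    ∃ R : ℝ, 0 ≤ R ∧ ∀ x a, net.Feasible x a → ‖a‖ ≤ R := by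
  obtain ⟨Cm, hCm, hcap⟩ := net.cap_bounded
  refine ⟨max (max |net.PAPm| 1) (max |net.Pm| Cm), by positivity, fun x a h => ?_⟩
  have hp := h.p_mem
  have h1 : ‖a.1‖ ≤ |net.PAPm| := by
    have h0 : 0 ≤ a.1 := h.pAP_mem.1
    rw [Real.norm_of_nonneg h0]
    exact h.pAP_mem.2.trans (le_abs_self _)
  have h2 : ‖a.2.1‖ ≤ 1 := by
    refine (pi_norm_le_iff_of_nonneg zero_le_one).2 fun m => ?_
    have hm : ‖a.2.1 m‖ ^ 2 ≤ ∑ m, ‖a.2.1 m‖ ^ 2 :=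
      Finset.single_le_sum (f := fun m => ‖a.2.1 m‖ ^ 2) (fun _ _ => by positivity)
        (Finset.mem_univ m)
    have hw : ∑ m, ‖a.2.1 m‖ ^ 2 = 1 := h.w_unit
    rw [hw] at hm
    exact (sq_le_one_iff₀ (norm_nonneg _)).1 hm
  have h3 : ‖a.2.2.1‖ ≤ |net.Pm| := by
    refine (pi_norm_le_iff_of_nonneg (abs_nonneg _)).2 fun l => ?_
    have : a.2.2.1 l ∈ Set.Icc 0 net.Pm := net.powerSet_peak _ hp l
    rw [Real.norm_of_nonneg this.1]
    exact this.2.trans (le_abs_self _)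
  have h4 : ‖a.2.2.2‖ ≤ Cm := by
    refine (pi_norm_le_iff_of_nonneg hCm.le).2 fun l =>
      (pi_norm_le_iff_of_nonneg hCm.le).2 fun s => ?_
    have h0 := h.c_nonneg l s
    rw [Real.norm_of_nonneg (by exact h0)]
    calc _ ≤ ∑ s, Action.c a l s :=
          Finset.single_le_sum (f := fun s => Action.c a l s) (fun s _ => h.c_nonneg l s)
            (Finset.mem_univ s)
      _ ≤ _ := (h.c_le_cap l).trans (hcap l _ hp _)
  refine norm_prod_le_iff.2 ⟨h1.trans ((le_max_left _ _).trans (le_max_left _ _)),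
    norm_prod_le_iff.2 ⟨h2.trans ((le_max_right _ _).trans (le_max_left _ _)),
      norm_prod_le_iff.2 ⟨h3.trans ((le_max_left _ _).trans (le_max_right _ _)),
        h4.trans ((le_max_right _ _).trans (le_max_right _ _))⟩⟩⟩

theorem abs_pAP_le {R : ℝ} {a : Action 𝕜 L S M} (h : ‖a‖ ≤ R) : |Action.pAP a| ≤ R :=
  (norm_fst_le a).trans h

theorem abs_p_le {R : ℝ} {a : Action 𝕜 L S M} (h : ‖a‖ ≤ R) (l : Fin L) : |Action.p a l| ≤ R :=
  (norm_le_pi_norm a.2.2.1 l).trans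
    ((norm_fst_le a.2.2).trans ((norm_snd_le a.2).trans ((norm_snd_le a).trans h)))

theorem abs_c_le {R : ℝ} {a : Action 𝕜 L S M} (h : ‖a‖ ≤ R) (l : Fin L) (s : Fin S) :
    |Action.c a l s| ≤ R :=
  (norm_le_pi_norm (a.2.2.2 l) s).trans ((norm_le_pi_norm a.2.2.2 l).trans
    ((norm_snd_le a.2.2).trans ((norm_snd_le a.2).trans ((norm_snd_le a).trans h))))

theorem norm_w_le {R : ℝ} {a : Action 𝕜 L S M} (h : ‖a‖ ≤ R) (m : Fin M) : ‖Action.w a m‖ ≤ R :=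
  (norm_le_pi_norm a.2.1 m).trans ((norm_fst_le a.2).trans ((norm_snd_le a).trans h))

/-- Cauchy–Schwarz, with one factor `R` from the EAP power and two from the beamforming vector. The
bound is integrable because the channels have finite mean energy. -/
theorem abs_received_le {R : ℝ} {a : Action 𝕜 L S M} (h : ‖a‖ ≤ R) (x : State 𝕜 N L S M)
    (n : Fin N) : |received x a n| ≤ R ^ 3 * (M * ∑ m, ‖State.h x n m‖ ^ 2) := by
  have hR : 0 ≤ R := (norm_nonneg a).trans h
  have h1 : ‖∑ m, Action.w a m * State.h x n m‖ ≤ R * ∑ m, ‖State.h x n m‖ := by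
    rw [Finset.mul_sum]
    refine (norm_sum_le _ _).trans (Finset.sum_le_sum fun m _ => ?_)
    rw [norm_mul]
    exact mul_le_mul_of_nonneg_right (norm_w_le h m) (norm_nonneg _)
  have h2 : (∑ m, ‖State.h x n m‖) ^ 2 ≤ M * ∑ m, ‖State.h x n m‖ ^ 2 := by
    simpa using sq_sum_le_card_mul_sum_sq (s := Finset.univ) (f := fun m => ‖State.h x n m‖)
  rw [received, abs_mul, abs_of_nonneg (sq_nonneg ‖_‖)]
  calc _ ≤ R * (R * ∑ m, ‖State.h x n m‖) ^ 2 := by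
        gcongr
        exact abs_pAP_le h
    _ = R ^ 3 * (∑ m, ‖State.h x n m‖) ^ 2 := by ring
    _ ≤ _ := by gcongr

/-- Joint laws of the state and a feasible decision. -/
structure IsJointLaw (net : WPCN 𝕜 N L S M) (μ : Measure (State 𝕜 N L S M))
    (ρ : Measure (State 𝕜 N L S M × Action 𝕜 L S M)) : Prop where
  prob : IsProbabilityMeasure ρ
  fst_eq : ρ.fst = μ
  feasible : ∀ᵐ z ∂ρ, net.Feasible z.1 z.2

variable {net : WPCN 𝕜 N L S M} {μ : Measure (State 𝕜 N L S M)}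
  {ρ : Measure (State 𝕜 N L S M × Action 𝕜 L S M)}

theorem IsStateLaw.integrable_arrivals (hμ : net.IsStateLaw μ) (n : Fin N) (s : Fin S) :
    Integrable (fun x => State.A x n s) μ := by
  have := hμ.prob
  obtain ⟨Am, h⟩ := hμ.arrivals_bounded
  refine Integrable.of_bound (C := Am)
    (by unfold State.A; exact Measurable.aestronglyMeasurable (by fun_prop)) ?_
  filter_upwards [h] with x hx
  rw [Real.norm_of_nonneg (hx n s).1]
  exact (hx n s).2

theorem IsStateLaw.integrable_energy (hμ : net.IsStateLaw μ) (R : ℝ) (n : Fin N) :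
    Integrable (fun x => R ^ 3 * (M * ∑ m, ‖State.h x n m‖ ^ 2)) μ :=
  ((integrable_finsetSum _ fun m _ => hμ.channel_energy n m).const_mul _).const_mul _

namespace IsJointLaw

theorem integrable_comp_fst (hρ : net.IsJointLaw μ ρ) {f : State 𝕜 N L S M → ℝ}
    (hf : Integrable f μ) : Integrable (fun z => f z.1) ρ := by
  rw [← hρ.fst_eq] at hf
  exact hf.comp_measurable measurable_fst

theorem integral_comp_fst (hρ : net.IsJointLaw μ ρ) {f : State 𝕜 N L S M → ℝ}
    (hf : Integrable f μ) : ∫ z, f z.1 ∂ρ = ∫ x, f x ∂μ := by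
  have h := hf.aestronglyMeasurable
  rw [← hρ.fst_eq, Measure.fst] at h ⊢
  exact (integral_map measurable_fst.aemeasurable h).symm

theorem integrable_of_bound (hρ : net.IsJointLaw μ ρ)
    {f : State 𝕜 N L S M × Action 𝕜 L S M → ℝ} (hf : Measurable f)
    (h : ∀ R, ∀ z : State 𝕜 N L S M × Action 𝕜 L S M, ‖z.2‖ ≤ R → |f z| ≤ R) :
    Integrable f ρ := by
  have := hρ.prob
  obtain ⟨R, -, hR⟩ := net.exists_norm_le_of_feasible
  refine Integrable.of_bound (C := R) hf.aestronglyMeasurable ?_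
  filter_upwards [hρ.feasible] with z hz
  exact h R z (hR _ _ hz)

theorem integrable_pAP (hρ : net.IsJointLaw μ ρ) : Integrable (fun z => Action.pAP z.2) ρ :=
  hρ.integrable_of_bound (by unfold Action.pAP; fun_prop) fun _ _ h => abs_pAP_le h

theorem integrable_p (hρ : net.IsJointLaw μ ρ) (l : Fin L) :
    Integrable (fun z => Action.p z.2 l) ρ :=
  hρ.integrable_of_bound (by unfold Action.p; fun_prop) fun _ _ h => abs_p_le h l

theorem integrable_c (hρ : net.IsJointLaw μ ρ) (l : Fin L) (s : Fin S) :
    Integrable (fun z => Action.c z.2 l s) ρ :=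
  hρ.integrable_of_bound (by unfold Action.c; fun_prop) fun _ _ h => abs_c_le h l s

theorem integrable_received (hμ : net.IsStateLaw μ) (hρ : net.IsJointLaw μ ρ) (n : Fin N) :
    Integrable (fun z => received z.1 z.2 n) ρ := by
  obtain ⟨R, -, hR⟩ := net.exists_norm_le_of_feasible
  refine (hρ.integrable_comp_fst (hμ.integrable_energy R n)).mono'
    (measurable_received n).aestronglyMeasurable ?_
  filter_upwards [hρ.feasible] with z hz
  exact abs_received_le (hR _ _ hz) z.1 n

end IsJointLaw

/-- Compactness of the joint laws: costs that can be made arbitrarily small can be made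
nonpositive. -/
theorem exists_jointLaw_integral_le_zero (hμ : IsProbabilityMeasure μ) {ι : Type*}
    (φ : ι → State 𝕜 N L S M → Action 𝕜 L S M → ℝ) (b : ℝ → ι → State 𝕜 N L S M → ℝ)
    (hb : ∀ R i, Integrable (b R i) μ) (hφb : ∀ R i x a, ‖a‖ ≤ R → |φ i x a| ≤ b R i x)
    (hφc : ∀ i x, Continuous (φ i x))
    (hφm : ∀ i, Measurable fun z : State 𝕜 N L S M × Action 𝕜 L S M => φ i z.1 z.2)
    (h : ∀ ε > 0, ∃ ρ, net.IsJointLaw μ ρ ∧ ∀ i, ∫ z, φ i z.1 z.2 ∂ρ ≤ ε) :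
    ∃ ρ, net.IsJointLaw μ ρ ∧ ∀ i, ∫ z, φ i z.1 z.2 ∂ρ ≤ 0 := by
  classical
  obtain ⟨R, hR0, hR⟩ := net.exists_norm_le_of_feasible
  let K := Metric.closedBall (0 : Action 𝕜 L S M) R
  have hK (a : K) : ‖(a : Action 𝕜 L S M)‖ ≤ R := mem_closedBall_zero_iff.1 a.2
  have : CompactSpace K := isCompact_iff_compactSpace.1 (isCompact_closedBall _ _)
  have hne : Nonempty K := ⟨⟨0, Metric.mem_closedBall_self hR0⟩⟩
  have hKm : MeasurableSet (Metric.closedBall (0 : Action 𝕜 L S M) R) :=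
    Metric.isClosed_closedBall.measurableSet
  have : StandardBorelSpace K := hKm.standardBorel
  -- Moves joint laws to the compact ball `K`. The value outside the ball is irrelevant, since
  -- feasible decisions lie inside.
  let r : Action 𝕜 L S M → K := fun a =>
    if ha : a ∈ Metric.closedBall (0 : Action 𝕜 L S M) R then ⟨a, ha⟩ else hne.some
  have hr : Measurable r := Measurable.dite measurable_id measurable_const hKm
  have hr_eq {x : State 𝕜 N L S M} {a : Action 𝕜 L S M} (ha : net.Feasible x a) :
      (r a : Action 𝕜 L S M) = a := by
    have : a ∈ Metric.closedBall (0 : Action 𝕜 L S M) R := mem_closedBall_zero_iff.2 (hR x a ha)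
    simp only [r, this, dif_pos]
  have hval : Measurable fun z : State 𝕜 N L S M × K => (z.1, (z.2 : Action 𝕜 L S M)) := by
    fun_prop
  have hφm' (i : ι) : Measurable fun z : State 𝕜 N L S M × K => φ i z.1 z.2 := (hφm i).comp hval
  have hint (i : ι) (κ : Kernel (State 𝕜 N L S M) K) [IsMarkovKernel κ] :
      Integrable (fun z : State 𝕜 N L S M × K => φ i z.1 z.2) (μ ⊗ₘ κ) := by
    have h1 : Integrable (fun z : State 𝕜 N L S M × K => b R i z.1) (μ ⊗ₘ κ) := by
      have := hb R i
      rw [← Measure.fst_compProd μ κ] at this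
      exact this.comp_measurable measurable_fst
    exact h1.mono' (hφm' i).aestronglyMeasurable
      (ae_of_all _ fun z => hφb R i z.1 z.2 (hK z.2))
  obtain ⟨κ, hκ, hκΓ, hκφ⟩ := Kernel.exists_integral_le_zero μ
    (fun x => {a : K | net.Feasible x a})
    (fun x => (net.isClosed_feasible x).preimage continuous_subtype_val)
    (fun i x (a : K) => φ i x a) (b R) (hb R) (fun i x a => hφb R i x a (hK a))
    (fun i x => (hφc i x).comp continuous_subtype_val) hφm' (by
      intro ε hε
      obtain ⟨ρ, hρ, hρφ⟩ := h ε hε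
      have := hρ.prob
      have hm : Measurable fun z : State 𝕜 N L S M × Action 𝕜 L S M => (z.1, r z.2) := by fun_prop
      let ρ' := ρ.map fun z => (z.1, r z.2)
      have : IsProbabilityMeasure ρ' := Measure.isProbabilityMeasure_map hm.aemeasurable
      have hfst : ρ'.fst = μ := by
        rw [← hρ.fst_eq, Measure.fst, Measure.map_map measurable_fst hm]
        rfl
      have hdis : μ ⊗ₘ ρ'.condKernel = ρ' := by
        rw [← hfst]
        exact ρ'.disintegrate ρ'.condKernel
      refine ⟨ρ'.condKernel, inferInstance, ?_, fun i => ?_⟩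
      · have h1 : ∀ᵐ z ∂ρ', net.Feasible z.1 z.2 := by
          refine (ae_map_iff hm.aemeasurable (net.measurableSet_feasible.preimage hval)).2 ?_
          filter_upwards [hρ.feasible] with z hz
          simpa only [hr_eq hz] using hz
        rw [← hdis] at h1
        filter_upwards [Measure.ae_ae_of_ae_compProd h1] with x hx
        exact ae_iff.1 hx
      · rw [← Measure.integral_compProd (f := fun z : State 𝕜 N L S M × K => φ i z.1 z.2)
          (hint i _), hdis, integral_map hm.aemeasurable (hφm' i).aestronglyMeasurable]
        refine le_of_eq_of_le (integral_congr_ae ?_) (hρφ i)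
        filter_upwards [hρ.feasible] with z hz
        simp only [hr_eq hz])
  refine ⟨(μ ⊗ₘ κ).map fun z => (z.1, (z.2 : Action 𝕜 L S M)),
    ⟨Measure.isProbabilityMeasure_map hval.aemeasurable, ?_, ?_⟩, fun i => ?_⟩
  · rw [Measure.fst, Measure.map_map measurable_fst hval]
    exact Measure.fst_compProd μ κ
  · refine (ae_map_iff hval.aemeasurable net.measurableSet_feasible).2 ?_
    refine Measure.ae_compProd_of_ae_ae (net.measurableSet_feasible.preimage hval) ?_
    filter_upwards [hκΓ] with x hx
    exact ae_iff.2 hx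
  · rw [integral_map hval.aemeasurable (hφm i).aestronglyMeasurable,
      Measure.integral_compProd (hint i κ)]
    exact hκφ i

end WPCN

/-! ### Time averages of real sequences. -/

/-- A nonnegative sequence with bounded time averages is frequently sublinear. -/
theorem frequently_le_mul_of_isBoundedUnder_average {a : ℕ → ℝ} (ha : ∀ t, 0 ≤ a t)
    (h : IsBoundedUnder (· ≤ ·) atTop fun T : ℕ => (∑ t ∈ Finset.range T, a t) / T)
    {ε : ℝ} (hε : 0 < ε) : ∃ᶠ T : ℕ in atTop, a T ≤ ε * T := by
  obtain ⟨B, hB⟩ := h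
  rw [eventually_map, eventually_atTop] at hB
  obtain ⟨T₁, hT₁⟩ := hB
  intro hcon
  obtain ⟨T₂, hT₂⟩ := eventually_atTop.1 hcon
  -- If `a t > ε * t` for all large `t`, the block from `T` to `2 * T` contributes at least `ε * T ^
  -- 2`, whereas the average bound `B` at `2 * T` allows only `2 * B * T`. So `T > 2 * B / ε` is
  -- contradictory.
  obtain ⟨k, hk⟩ := exists_nat_gt (2 * B / ε)
  let T := max (max T₁ T₂) (max k 1)
  have h1 : T₁ ≤ T := (le_max_left _ _).trans (le_max_left _ _)
  have h2 : T₂ ≤ T := (le_max_right _ _).trans (le_max_left _ _)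
  have h3 : k ≤ T := (le_max_left _ _).trans (le_max_right _ _)
  have h4 : 1 ≤ T := (le_max_right _ _).trans (le_max_right _ _)
  have hT : (0 : ℝ) < T := by exact_mod_cast h4
  have hsum : T * (ε * T) ≤ ∑ t ∈ Finset.range (2 * T), a t := by
    calc T * (ε * T) = ∑ t ∈ Finset.Ico T (2 * T), ε * (T : ℝ) := by
          rw [Finset.sum_const, Nat.card_Ico, nsmul_eq_mul, two_mul, Nat.add_sub_cancel]
      _ ≤ ∑ t ∈ Finset.Ico T (2 * T), a t := by
          refine Finset.sum_le_sum fun t ht => ?_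
          have htT := (Finset.mem_Ico.1 ht).1
          have : ε * t < a t := not_le.1 (hT₂ t (h2.trans htT))
          have : ε * (T : ℝ) ≤ ε * t := by gcongr
          linarith
      _ ≤ _ := Finset.sum_le_sum_of_subset_of_nonneg
          (fun t ht => Finset.mem_range.2 (Finset.mem_Ico.1 ht).2) fun t _ _ => ha t
  have hle := hT₁ (2 * T) (by omega)
  push_cast at hle
  rw [div_le_iff₀ (by positivity)] at hle
  have h5 : 2 * B < ε * T := by
    rw [div_lt_iff₀ hε] at hk
    calc 2 * B < k * ε := hk
      _ ≤ T * ε := by gcongr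
      _ = _ := mul_comm _ _
  nlinarith

/-- The time averages of a sequence that is bounded above by `C` are bounded above by `C`. -/
theorem average_le {x : ℕ → ℝ} {C : ℝ} (hC : 0 ≤ C) (h : ∀ t, x t ≤ C) (T : ℕ) :
    (∑ t ∈ Finset.range T, x t) / T ≤ C := by
  refine div_le_of_le_mul₀ (Nat.cast_nonneg T) hC ?_
  calc _ ≤ ∑ t ∈ Finset.range T, C := Finset.sum_le_sum fun t _ => h t
    _ = _ := by simp [mul_comm]

/-! ### Expectations along a policy, queue drift, and time-averaged laws. -/

namespace WPCN

variable {𝕜 : Type} [RCLike 𝕜] {N L S M : ℕ} {net : WPCN 𝕜 N L S M}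
  {μ : Measure (State 𝕜 N L S M)}

namespace Policy

/-- The joint law of state and decision in a slot. -/
noncomputable def law (π : Policy net μ) (t : ℕ) :
    Measure (State 𝕜 N L S M × Action 𝕜 L S M) :=
  π.P.map fun ω => (π.X t ω, π.act t ω)

theorem measurable_pair (π : Policy net μ) (t : ℕ) :
    Measurable fun ω => (π.X t ω, π.act t ω) :=
  (π.X_measurable t).prodMk (π.act_measurable t)

theorem isJointLaw_law (π : Policy net μ) (t : ℕ) : net.IsJointLaw μ (π.law t) where
  prob := Measure.isProbabilityMeasure_map (π.measurable_pair t).aemeasurable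
  fst_eq := by
    rw [law, Measure.fst, Measure.map_map measurable_fst (π.measurable_pair t)]
    exact π.X_law t
  feasible := (ae_map_iff (π.measurable_pair t).aemeasurable net.measurableSet_feasible).2
    (π.feasible t)

theorem integral_law (π : Policy net μ) (t : ℕ)
    {f : State 𝕜 N L S M × Action 𝕜 L S M → ℝ} (hf : Measurable f) :
    ∫ z, f z ∂π.law t = ∫ ω, f (π.X t ω, π.act t ω) ∂π.P :=
  integral_map (π.measurable_pair t).aemeasurable hf.aestronglyMeasurable

theorem meanEAP_eq (π : Policy net μ) (t : ℕ) : π.meanEAP t = ∫ z, Action.pAP z.2 ∂π.law t :=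
  (π.integral_law t (f := fun z => Action.pAP z.2) (by unfold Action.pAP; fun_prop)).symm

theorem meanPower_eq (π : Policy net μ) (t : ℕ) (l : Fin L) :
    π.meanPower t l = ∫ z, Action.p z.2 l ∂π.law t :=
  (π.integral_law t (f := fun z => Action.p z.2 l) (by unfold Action.p; fun_prop)).symm

theorem meanRate_eq (π : Policy net μ) (t : ℕ) (l : Fin L) (s : Fin S) :
    π.meanRate t l s = ∫ z, Action.c z.2 l s ∂π.law t :=
  (π.integral_law t (f := fun z => Action.c z.2 l s) (by unfold Action.c; fun_prop)).symm

theorem meanReceived_eq (π : Policy net μ) (t : ℕ) (n : Fin N) :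
    π.meanReceived t n = ∫ z, received z.1 z.2 n ∂π.law t :=
  (π.integral_law t (measurable_received n)).symm

theorem integrable_of_law (π : Policy net μ) (t : ℕ)
    {f : State 𝕜 N L S M × Action 𝕜 L S M → ℝ} (hf : Integrable f (π.law t)) :
    Integrable (fun ω => f (π.X t ω, π.act t ω)) π.P :=
  hf.comp_measurable (π.measurable_pair t)

theorem integrable_rate (π : Policy net μ) (t : ℕ) (l : Fin L) (s : Fin S) :
    Integrable (fun ω => Action.c (π.act t ω) l s) π.P :=
  π.integrable_of_law t ((π.isJointLaw_law t).integrable_c l s)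

theorem integrable_arrivals (hμ : net.IsStateLaw μ) (π : Policy net μ) (t : ℕ) (n : Fin N)
    (s : Fin S) : Integrable (fun ω => State.A (π.X t ω) n s) π.P :=
  π.integrable_of_law t ((π.isJointLaw_law t).integrable_comp_fst (hμ.integrable_arrivals n s))

theorem integral_arrivals (hμ : net.IsStateLaw μ) (π : Policy net μ) (t : ℕ) (n : Fin N)
    (s : Fin S) : ∫ ω, State.A (π.X t ω) n s ∂π.P = arrivalRate μ n s := by
  rw [arrivalRate, ← (π.isJointLaw_law t).integral_comp_fst (hμ.integrable_arrivals n s)]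
  exact (π.integral_law t (f := fun z => State.A z.1 n s) (by unfold State.A; fun_prop)).symm

theorem integrable_backlog (hμ : net.IsStateLaw μ) (π : Policy net μ) (t : ℕ) (n : Fin N)
    (s : Fin S) : Integrable (fun ω => π.backlog t ω n s) π.P := by
  induction t with
  | zero => simp only [backlog]; exact integrable_const _
  | succ t ih =>
    simp only [backlog]
    split_ifs
    · exact integrable_const _
    · exact (((ih.sub (integrable_finsetSum _ fun l _ => π.integrable_rate t l s)).sup
        (integrable_const 0)).add (integrable_finsetSum _ fun l _ => π.integrable_rate t l s)).add
          (π.integrable_arrivals hμ t n s)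

theorem backlog_nonneg (hμ : net.IsStateLaw μ) (π : Policy net μ) (t : ℕ) (n : Fin N)
    (s : Fin S) : ∀ᵐ ω ∂π.P, 0 ≤ π.backlog t ω n s := by
  cases t with
  | zero =>
    refine ae_of_all _ fun ω => ?_
    simp only [backlog]
    split_ifs
    exacts [le_rfl, net.U0_nonneg n s]
  | succ t =>
    obtain ⟨Am, hA⟩ := hμ.arrivals_bounded
    have hA' : ∀ᵐ ω ∂π.P, ∀ n s, State.A (π.X t ω) n s ∈ Set.Icc 0 Am := by
      rw [← π.X_law t] at hA
      exact ae_of_ae_map (π.X_measurable t).aemeasurable hA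
    filter_upwards [hA', π.feasible t] with ω h1 h2
    simp only [backlog]
    split_ifs
    · exact le_rfl
    · exact add_nonneg (add_nonneg (le_max_right _ _)
        (Finset.sum_nonneg fun l _ => h2.c_nonneg l s)) (h1 n s).1

theorem meanBacklog_nonneg (hμ : net.IsStateLaw μ) (π : Policy net μ) (t : ℕ) (n : Fin N)
    (s : Fin S) : 0 ≤ π.meanBacklog t n s :=
  integral_nonneg_of_ae (π.backlog_nonneg hμ t n s)

/-- The positive part in the queue recursion is bounded below by its argument, which leaves a bound
linear in the rates. -/
theorem meanBacklog_succ_ge (hμ : net.IsStateLaw μ) (π : Policy net μ) (t : ℕ) {n : Fin N}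
    {s : Fin S} (hn : n ≠ net.dst s) :
    π.meanBacklog t n s + (arrivalRate μ n s + ∑ l ∈ net.inLinks n, π.meanRate t l s
      - ∑ l ∈ net.outLinks n, π.meanRate t l s) ≤ π.meanBacklog (t + 1) n s := by
  have hout := integrable_finsetSum (net.outLinks n) fun l _ => π.integrable_rate t l s
  have hin := integrable_finsetSum (net.inLinks n) fun l _ => π.integrable_rate t l s
  have hU := π.integrable_backlog hμ t n s
  have hA := π.integrable_arrivals hμ t n s
  have h1 : Integrable (fun ω => π.backlog t ω n s
      - ∑ l ∈ net.outLinks n, Action.c (π.act t ω) l s) π.P := hU.sub hout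
  have h2 : Integrable (fun ω => π.backlog t ω n s
      - ∑ l ∈ net.outLinks n, Action.c (π.act t ω) l s
      + ∑ l ∈ net.inLinks n, Action.c (π.act t ω) l s) π.P := h1.add hin
  have h : ∫ ω, (π.backlog t ω n s - ∑ l ∈ net.outLinks n, Action.c (π.act t ω) l s
      + ∑ l ∈ net.inLinks n, Action.c (π.act t ω) l s + State.A (π.X t ω) n s) ∂π.P
      ≤ π.meanBacklog (t + 1) n s := by
    refine integral_mono (h2.add hA) (π.integrable_backlog hμ (t + 1) n s)
      fun ω => ?_
    simp only [backlog, if_neg hn]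
    gcongr
    exact le_max_left _ _
  rw [integral_add h2 hA, integral_add h1 hin,
    integral_sub hU hout, integral_finsetSum _ fun l _ => π.integrable_rate t l s,
    integral_finsetSum _ fun l _ => π.integrable_rate t l s, π.integral_arrivals hμ] at h
  unfold meanBacklog meanRate at *
  linarith

theorem sum_drift_le_meanBacklog (hμ : net.IsStateLaw μ) (π : Policy net μ) (T : ℕ) {n : Fin N}
    {s : Fin S} (hn : n ≠ net.dst s) :
    ∑ t ∈ Finset.range T, (arrivalRate μ n s + ∑ l ∈ net.inLinks n, π.meanRate t l s
      - ∑ l ∈ net.outLinks n, π.meanRate t l s) ≤ π.meanBacklog T n s := by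
  induction T with
  | zero => simpa using π.meanBacklog_nonneg hμ 0 n s
  | succ T ih =>
    rw [Finset.sum_range_succ]
    linarith [π.meanBacklog_succ_ge hμ T hn]

theorem meanEAP_mem (π : Policy net μ) (t : ℕ) : π.meanEAP t ∈ Set.Icc 0 net.PAPm := by
  have hint := π.integrable_of_law t (π.isJointLaw_law t).integrable_pAP
  refine ⟨integral_nonneg_of_ae ?_, ?_⟩
  · filter_upwards [π.feasible t] with ω h using h.pAP_mem.1
  · calc _ ≤ ∫ _, net.PAPm ∂π.P := by
          refine integral_mono_ae hint (integrable_const _) ?_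
          filter_upwards [π.feasible t] with ω h using h.pAP_mem.2
      _ = _ := by simp

theorem PAPm_nonneg (π : Policy net μ) : 0 ≤ net.PAPm :=
  (π.meanEAP_mem 0).1.trans (π.meanEAP_mem 0).2

theorem averageEAP_mem (π : Policy net μ) (T : ℕ) :
    (∑ t ∈ Finset.range T, π.meanEAP t) / T ∈ Set.Icc 0 net.PAPm :=
  ⟨div_nonneg (Finset.sum_nonneg fun t _ => (π.meanEAP_mem t).1) (Nat.cast_nonneg T),
    average_le π.PAPm_nonneg (fun t => (π.meanEAP_mem t).2) T⟩

/-- A real `limsup` yields eventual inequalities only for sequences that are bounded above. -/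
theorem isBoundedUnder_averageEAP (π : Policy net μ) :
    IsBoundedUnder (· ≤ ·) atTop fun T : ℕ => (∑ t ∈ Finset.range T, π.meanEAP t) / T :=
  isBoundedUnder_of ⟨net.PAPm, fun T => (π.averageEAP_mem T).2⟩

theorem avgEAP_mem (π : Policy net μ) : π.avgEAP ∈ Set.Icc 0 net.PAPm :=
  ⟨le_limsup_of_frequently_le (Eventually.of_forall fun T => (π.averageEAP_mem T).1).frequently
      π.isBoundedUnder_averageEAP,
    limsup_le_of_le (isBoundedUnder_of ⟨0, fun T => (π.averageEAP_mem T).1⟩).isCoboundedUnder_le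
      (Eventually.of_forall fun T => (π.averageEAP_mem T).2)⟩

theorem meanReceived_nonneg (π : Policy net μ) (t : ℕ) (n : Fin N) : 0 ≤ π.meanReceived t n := by
  refine integral_nonneg_of_ae ?_
  filter_upwards [π.feasible t] with ω h using mul_nonneg h.pAP_mem.1 (by positivity)

/-- Peak powers bound the consumption and received powers are nonnegative. This makes the `limsup`
in the average power constraint usable. -/
theorem isBoundedUnder_averagePower (π : Policy net μ) (n : Fin N) :
    IsBoundedUnder (· ≤ ·) atTop fun T : ℕ => (∑ t ∈ Finset.range T,
      ((∑ l ∈ net.outLinks n, π.meanPower t l) - π.meanReceived t n)) / T := by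
  have hp (t : ℕ) (l : Fin L) : π.meanPower t l ≤ |net.Pm| := by
    calc _ ≤ ∫ _, |net.Pm| ∂π.P := by
          refine integral_mono_ae (π.integrable_of_law t ((π.isJointLaw_law t).integrable_p l))
            (integrable_const _) ?_
          filter_upwards [π.feasible t] with ω h
          exact (net.powerSet_peak _ h.p_mem l).2.trans (le_abs_self _)
      _ = _ := by simp
  refine isBoundedUnder_of ⟨∑ l ∈ net.outLinks n, |net.Pm|, fun T => average_le
    (Finset.sum_nonneg fun _ _ => abs_nonneg _) (fun t => ?_) T⟩
  linarith [π.meanReceived_nonneg t n, Finset.sum_le_sum fun l (_ : l ∈ net.outLinks n) => hp t l]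

/-- The time average of the joint laws of the first `T` slots. -/
noncomputable def averageLaw (π : Policy net μ) (T : ℕ) :
    Measure (State 𝕜 N L S M × Action 𝕜 L S M) :=
  (T : ENNReal)⁻¹ • ∑ t ∈ Finset.range T, π.law t

/-- All slots share the state marginal `μ`, and infeasibility is a null event in each, so both
survive averaging. For `T = 0` the average is the zero measure. -/
theorem isJointLaw_averageLaw (π : Policy net μ) {T : ℕ} (hT : T ≠ 0) :
    net.IsJointLaw μ (π.averageLaw T) := by
  have hT0 : (T : ENNReal) ≠ 0 := by exact_mod_cast hT
  have hfst : (π.averageLaw T).fst = μ := by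
    ext B hB
    have h (t : ℕ) : π.law t (Prod.fst ⁻¹' B) = μ B := by
      rw [← Measure.fst_apply hB, (π.isJointLaw_law t).fst_eq]
    rw [Measure.fst_apply hB]
    simp only [averageLaw, Measure.smul_apply, Measure.finsetSum_apply, h, Finset.sum_const,
      Finset.card_range, nsmul_eq_mul, smul_eq_mul]
    rw [← mul_assoc, ENNReal.inv_mul_cancel hT0 (ENNReal.natCast_ne_top T), one_mul]
  refine ⟨⟨?_⟩, hfst, ?_⟩
  · have h (t : ℕ) : π.law t Set.univ = 1 := (π.isJointLaw_law t).prob.measure_univ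
    simp only [averageLaw, Measure.smul_apply, Measure.finsetSum_apply, h, Finset.sum_const,
      Finset.card_range, nsmul_eq_mul, smul_eq_mul, mul_one]
    exact ENNReal.inv_mul_cancel hT0 (ENNReal.natCast_ne_top T)
  · rw [ae_iff]
    have h (t : ℕ) := ae_iff.1 (π.isJointLaw_law t).feasible
    simp [averageLaw, h]

theorem integral_averageLaw (π : Policy net μ) (T : ℕ)
    {f : State 𝕜 N L S M × Action 𝕜 L S M → ℝ} (hf : ∀ t, Integrable f (π.law t)) :
    ∫ z, f z ∂π.averageLaw T = (∑ t ∈ Finset.range T, ∫ z, f z ∂π.law t) / T := by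
  rw [averageLaw, integral_smul_measure, integral_finsetSum_measure fun t _ => hf t]
  simp [div_eq_inv_mul]

end Policy

end WPCN

/-! ### Costs of joint laws, near-optimal laws, and attainment of the minimum power. -/

namespace WPCN

variable {𝕜 : Type} [RCLike 𝕜] {N L S M : ℕ} {net : WPCN 𝕜 N L S M}
  {μ : Measure (State 𝕜 N L S M)} {ρ : Measure (State 𝕜 N L S M × Action 𝕜 L S M)}

/-- The excess of the EAP power over the budget `P`, the drift of the data queues, and the power
deficits of the nodes. -/
noncomputable def cost (net : WPCN 𝕜 N L S M) (P : ℝ) :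
    Unit ⊕ (Fin N × Fin S) ⊕ Fin N → State 𝕜 N L S M → Action 𝕜 L S M → ℝ
  | .inl _, _, a => Action.pAP a - P
  | .inr (.inl (n, s)), x, a =>
      if n = net.dst s then 0 else
        State.A x n s + ∑ l ∈ net.inLinks n, Action.c a l s - ∑ l ∈ net.outLinks n, Action.c a l s
  | .inr (.inr n), x, a => ∑ l ∈ net.outLinks n, Action.p a l - received x a n

/-- A bound of the costs over the decisions of norm at most `R`. -/
noncomputable def costBound (net : WPCN 𝕜 N L S M) (P R : ℝ) :
    Unit ⊕ (Fin N × Fin S) ⊕ Fin N → State 𝕜 N L S M → ℝ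
  | .inl _, _ => R + |P|
  | .inr (.inl (n, s)), x =>
      |State.A x n s| + ∑ _l ∈ net.inLinks n, |R| + ∑ _l ∈ net.outLinks n, |R|
  | .inr (.inr n), x => ∑ _l ∈ net.outLinks n, |R| + R ^ 3 * (M * ∑ m, ‖State.h x n m‖ ^ 2)

theorem IsStateLaw.integrable_costBound (hμ : net.IsStateLaw μ) (P R : ℝ)
    (i : Unit ⊕ (Fin N × Fin S) ⊕ Fin N) : Integrable (net.costBound P R i) μ := by
  have := hμ.prob
  match i with
  | .inl _ => exact integrable_const _
  | .inr (.inl (n, s)) =>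
    exact ((hμ.integrable_arrivals n s).abs.add (integrable_const _)).add (integrable_const _)
  | .inr (.inr n) => exact (integrable_const _).add (hμ.integrable_energy R n)

theorem abs_cost_le (P R : ℝ) (i : Unit ⊕ (Fin N × Fin S) ⊕ Fin N) (x : State 𝕜 N L S M)
    (a : Action 𝕜 L S M) (ha : ‖a‖ ≤ R) : |net.cost P i x a| ≤ net.costBound P R i x := by
  match i with
  | .inl _ => exact (abs_sub _ _).trans (add_le_add_left (abs_pAP_le ha) _)
  | .inr (.inl (n, s)) =>
    have h (t : Finset (Fin L)) : |∑ l ∈ t, Action.c a l s| ≤ ∑ _l ∈ t, |R| :=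
      (Finset.abs_sum_le_sum_abs _ _).trans
        (Finset.sum_le_sum fun l _ => (abs_c_le ha l s).trans (le_abs_self R))
    simp only [cost, costBound]
    split_ifs
    · rw [abs_zero]
      positivity
    · exact (abs_sub _ _).trans (add_le_add ((abs_add_le _ _).trans (add_le_add le_rfl (h _))) (h _))
  | .inr (.inr n) =>
    refine (abs_sub _ _).trans (add_le_add ?_ (abs_received_le ha x n))
    exact (Finset.abs_sum_le_sum_abs _ _).trans
      (Finset.sum_le_sum fun l _ => (abs_p_le ha l).trans (le_abs_self R))

theorem continuous_cost (P : ℝ) (i : Unit ⊕ (Fin N × Fin S) ⊕ Fin N) (x : State 𝕜 N L S M) :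
    Continuous (net.cost P i x) := by
  match i with
  | .inl _ =>
    change Continuous fun a : Action 𝕜 L S M => a.1 - P
    fun_prop
  | .inr (.inl (n, s)) =>
    change Continuous fun a : Action 𝕜 L S M => if n = net.dst s then 0 else
      x.2.2 n s + ∑ l ∈ net.inLinks n, a.2.2.2 l s - ∑ l ∈ net.outLinks n, a.2.2.2 l s
    split_ifs <;> fun_prop
  | .inr (.inr n) =>
    have := continuous_received (L := L) (S := S) x n
    change Continuous fun a : Action 𝕜 L S M => ∑ l ∈ net.outLinks n, a.2.2.1 l - received x a n
    fun_prop

theorem measurable_cost (P : ℝ) (i : Unit ⊕ (Fin N × Fin S) ⊕ Fin N) :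
    Measurable fun z : State 𝕜 N L S M × Action 𝕜 L S M => net.cost P i z.1 z.2 := by
  match i with
  | .inl _ => simp only [cost, Action.pAP]; fun_prop
  | .inr (.inl (n, s)) =>
    simp only [cost]
    split_ifs
    · exact measurable_const
    · unfold Action.c State.A
      fun_prop
  | .inr (.inr n) =>
    have := measurable_received (𝕜 := 𝕜) (N := N) (L := L) (S := S) (M := M) n
    simp only [cost, Action.p]
    fun_prop

namespace IsJointLaw

theorem integrable_cost (hμ : net.IsStateLaw μ) (hρ : net.IsJointLaw μ ρ) (P : ℝ)
    (i : Unit ⊕ (Fin N × Fin S) ⊕ Fin N) :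
    Integrable (fun z => net.cost P i z.1 z.2) ρ := by
  obtain ⟨R, -, hR⟩ := net.exists_norm_le_of_feasible
  refine (hρ.integrable_comp_fst (hμ.integrable_costBound P R i)).mono'
    (measurable_cost P i).aestronglyMeasurable ?_
  filter_upwards [hρ.feasible] with z hz
  exact abs_cost_le P R i z.1 z.2 (hR _ _ hz)

theorem integral_cost_inl (hρ : net.IsJointLaw μ ρ) (P : ℝ) (u : Unit) :
    ∫ z, net.cost P (.inl u) z.1 z.2 ∂ρ = ∫ z, Action.pAP z.2 ∂ρ - P := by
  have := hρ.prob
  simp only [cost]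
  rw [integral_sub hρ.integrable_pAP (integrable_const _)]
  simp

theorem integral_cost_queue (hμ : net.IsStateLaw μ) (hρ : net.IsJointLaw μ ρ) (P : ℝ) {n : Fin N}
    {s : Fin S} (hn : n ≠ net.dst s) :
    ∫ z, net.cost P (.inr (.inl (n, s))) z.1 z.2 ∂ρ = arrivalRate μ n s +
      ∑ l ∈ net.inLinks n, ∫ z, Action.c z.2 l s ∂ρ -
      ∑ l ∈ net.outLinks n, ∫ z, Action.c z.2 l s ∂ρ := by
  simp only [cost, if_neg hn]
  have hA := hρ.integrable_comp_fst (hμ.integrable_arrivals n s)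
  have hin := integrable_finsetSum (net.inLinks n) fun l _ => hρ.integrable_c l s
  have hout := integrable_finsetSum (net.outLinks n) fun l _ => hρ.integrable_c l s
  have h1 : Integrable (fun z => State.A z.1 n s + ∑ l ∈ net.inLinks n, Action.c z.2 l s) ρ :=
    hA.add hin
  rw [integral_sub h1 hout, integral_add hA hin,
    integral_finsetSum _ fun l _ => hρ.integrable_c l s,
    integral_finsetSum _ fun l _ => hρ.integrable_c l s,
    hρ.integral_comp_fst (hμ.integrable_arrivals n s)]
  rfl

theorem integral_cost_power (hμ : net.IsStateLaw μ) (hρ : net.IsJointLaw μ ρ) (P : ℝ) (n : Fin N) :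
    ∫ z, net.cost P (.inr (.inr n)) z.1 z.2 ∂ρ =
      ∑ l ∈ net.outLinks n, ∫ z, Action.p z.2 l ∂ρ - ∫ z, received z.1 z.2 n ∂ρ := by
  simp only [cost]
  rw [integral_sub (integrable_finsetSum _ fun l _ => hρ.integrable_p l)
    (hρ.integrable_received hμ n), integral_finsetSum _ fun l _ => hρ.integrable_p l]

end IsJointLaw

/-- Over suitable time horizons, a stabilizing policy under the average power constraint has almost
nonpositive average costs. -/
theorem Policy.exists_jointLaw_integral_cost_le (hμ : net.IsStateLaw μ) (π : Policy net μ)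
    (hs : π.IsStable) (hp : π.AvgPowerConstraint) {P ε : ℝ} (hε : 0 < ε) (hP : π.avgEAP < P + ε) :
    ∃ ρ, net.IsJointLaw μ ρ ∧ ∀ i, ∫ z, net.cost P i z.1 z.2 ∂ρ ≤ ε := by
  have ev1 := eventually_lt_of_limsup_lt hP π.isBoundedUnder_averageEAP
  have ev2 : ∀ᶠ T : ℕ in atTop, ∀ n, (∑ t ∈ Finset.range T,
      ((∑ l ∈ net.outLinks n, π.meanPower t l) - π.meanReceived t n)) / T < ε :=
    eventually_all.2 fun n => eventually_lt_of_limsup_lt ((hp n).trans_lt hε)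
      (π.isBoundedUnder_averagePower n)
  have fr := frequently_le_mul_of_isBoundedUnder_average (fun t => Finset.sum_nonneg fun n _ =>
    Finset.sum_nonneg fun s _ => π.meanBacklog_nonneg hμ t n s) hs hε
  -- The backlog bound holds only for arbitrarily large horizons, but the power bounds hold for all
  -- large ones, so a common horizon exists.
  obtain ⟨T, hU, h1, h2, hT⟩ := (fr.and_eventually
    (ev1.and (ev2.and (eventually_ne_atTop 0)))).exists
  have hT' : (0 : ℝ) < T := by exact_mod_cast Nat.pos_of_ne_zero hT
  refine ⟨π.averageLaw T, π.isJointLaw_averageLaw hT, fun i => ?_⟩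
  rw [π.integral_averageLaw T fun t => (π.isJointLaw_law t).integrable_cost hμ P i]
  match i with
  | .inl u =>
    simp only [(π.isJointLaw_law _).integral_cost_inl, ← π.meanEAP_eq]
    rw [div_lt_iff₀ hT'] at h1
    rw [Finset.sum_sub_distrib, div_le_iff₀ hT']
    simp only [Finset.sum_const, Finset.card_range, nsmul_eq_mul]
    linarith
  | .inr (.inl (n, s)) =>
    by_cases hn : n = net.dst s
    · simp only [cost, if_pos hn]
      simpa using hε.le
    · simp only [(π.isJointLaw_law _).integral_cost_queue hμ P hn, ← π.meanRate_eq]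
      rw [div_le_iff₀ hT']
      refine (π.sum_drift_le_meanBacklog hμ T hn).trans (le_trans ?_ hU)
      calc π.meanBacklog T n s ≤ ∑ s, π.meanBacklog T n s :=
            Finset.single_le_sum (f := fun s => π.meanBacklog T n s)
              (fun s _ => π.meanBacklog_nonneg hμ T n s) (Finset.mem_univ s)
        _ ≤ _ := Finset.single_le_sum (f := fun n => ∑ s, π.meanBacklog T n s)
              (fun n _ => Finset.sum_nonneg fun s _ => π.meanBacklog_nonneg hμ T n s)
              (Finset.mem_univ n)
  | .inr (.inr n) =>
    simp only [(π.isJointLaw_law _).integral_cost_power hμ P, ← π.meanPower_eq,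
      ← π.meanReceived_eq]
    exact (h2 n).le

/-- The EAP power can be raised to any mean value up to its peak, without changing the link powers
and rates and without decreasing the received powers. -/
theorem IsJointLaw.exists_integral_pAP_eq (hμ : net.IsStateLaw μ) (hρ : net.IsJointLaw μ ρ) {P : ℝ}
    (h1 : ∫ z, Action.pAP z.2 ∂ρ ≤ P) (h2 : P ≤ net.PAPm) :
    ∃ ρ', net.IsJointLaw μ ρ' ∧ ∫ z, Action.pAP z.2 ∂ρ' = P ∧
      (∀ l, ∫ z, Action.p z.2 l ∂ρ' = ∫ z, Action.p z.2 l ∂ρ) ∧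
      (∀ l s, ∫ z, Action.c z.2 l s ∂ρ' = ∫ z, Action.c z.2 l s ∂ρ) ∧
      ∀ n, ∫ z, received z.1 z.2 n ∂ρ ≤ ∫ z, received z.1 z.2 n ∂ρ' := by
  have := hρ.prob
  set e := ∫ z, Action.pAP z.2 ∂ρ with he
  -- Each EAP power is moved the fraction `θ` of its way to the peak, which moves the mean `e` to
  -- `P`. If `e` is already the peak, then `P = e` and `θ = 0` works.
  obtain ⟨θ, hθ0, hθ1, hθ⟩ : ∃ θ : ℝ, 0 ≤ θ ∧ θ ≤ 1 ∧ e + θ * (net.PAPm - e) = P := by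
    rcases (h1.trans h2).eq_or_lt with h | h
    · exact ⟨0, le_rfl, zero_le_one, by linarith⟩
    · have h0 : 0 < net.PAPm - e := sub_pos.2 h
      refine ⟨(P - e) / (net.PAPm - e), div_nonneg (sub_nonneg.2 h1) h0.le,
        (div_le_one h0).2 (by linarith), ?_⟩
      rw [div_mul_cancel₀ _ h0.ne']
      ring
  let B : State 𝕜 N L S M × Action 𝕜 L S M → State 𝕜 N L S M × Action 𝕜 L S M :=
    fun z => (z.1, (z.2.1 + θ * (net.PAPm - z.2.1), z.2.2))
  have hB : Measurable B := by fun_prop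
  have hlaw : net.IsJointLaw μ (ρ.map B) := by
    refine ⟨Measure.isProbabilityMeasure_map hB.aemeasurable, ?_, ?_⟩
    · rw [Measure.fst, Measure.map_map measurable_fst hB, ← hρ.fst_eq]
      rfl
    · refine (ae_map_iff hB.aemeasurable net.measurableSet_feasible).2 ?_
      filter_upwards [hρ.feasible] with z hz
      have h := hz.pAP_mem
      simp only [Action.pAP, Set.mem_Icc] at h
      refine ⟨?_, hz.w_unit, hz.p_mem, hz.c_nonneg, hz.c_le_cap⟩
      simp only [B, Action.pAP, Set.mem_Icc]
      constructor <;> nlinarith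
  have hint {f : State 𝕜 N L S M × Action 𝕜 L S M → ℝ} (hf : Integrable f (ρ.map B)) :
      ∫ z, f z ∂ρ.map B = ∫ z, f (B z) ∂ρ := integral_map hB.aemeasurable hf.aestronglyMeasurable
  refine ⟨ρ.map B, hlaw, ?_, fun l => hint (hlaw.integrable_p l),
    fun l s => hint (hlaw.integrable_c l s), fun n => ?_⟩
  · rw [hint hlaw.integrable_pAP]
    have h3 : Integrable (fun z => θ * (net.PAPm - Action.pAP z.2)) ρ :=
      ((integrable_const _).sub hρ.integrable_pAP).const_mul θ
    calc _ = ∫ z, (Action.pAP z.2 + θ * (net.PAPm - Action.pAP z.2)) ∂ρ := rfl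
      _ = e + θ * (net.PAPm - e) := by
        rw [integral_add hρ.integrable_pAP h3, integral_const_mul,
          integral_sub (integrable_const _) hρ.integrable_pAP]
        simp [he]
      _ = P := hθ
  · rw [hint (hlaw.integrable_received hμ n)]
    refine integral_mono_ae (hρ.integrable_received hμ n)
      ((hlaw.integrable_received hμ n).comp_measurable hB) ?_
    filter_upwards [hρ.feasible] with z hz
    refine mul_le_mul_of_nonneg_right ?_ (sq_nonneg _)
    have h := hz.pAP_mem.2
    simp only [Action.pAP] at h
    simp only [B, Action.pAP]
    nlinarith

/-- Compactness gives mean EAP power at most `minPower`. The reverse inequality is not automatic,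
since a policy that only balances mean rates need not be stable and so need not compete in the
infimum. Raising the power settles equality, which is possible because `minPower` is at most the
peak. -/
theorem exists_jointLaw_minPower (hμ : net.IsStateLaw μ) (hcap : net.InCapacityRegion μ) :
    ∃ ρ, net.IsJointLaw μ ρ ∧ ∫ z, Action.pAP z.2 ∂ρ = net.minPower μ ∧
      (∀ n s, n ≠ net.dst s → arrivalRate μ n s + ∑ l ∈ net.inLinks n, ∫ z, Action.c z.2 l s ∂ρ
        ≤ ∑ l ∈ net.outLinks n, ∫ z, Action.c z.2 l s ∂ρ) ∧
      ∀ n, ∑ l ∈ net.outLinks n, ∫ z, Action.p z.2 l ∂ρ ≤ ∫ z, received z.1 z.2 n ∂ρ := by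
  have hbelow : BddBelow {P | ∃ π : Policy net μ, π.IsStable ∧ π.AvgPowerConstraint ∧
      π.avgEAP = P} := ⟨0, by rintro _ ⟨π, -, -, rfl⟩; exact π.avgEAP_mem.1⟩
  obtain ⟨π₀, hs₀, hp₀⟩ := hcap
  have hle : net.minPower μ ≤ net.PAPm :=
    (csInf_le hbelow ⟨π₀, hs₀, hp₀, rfl⟩).trans π₀.avgEAP_mem.2
  obtain ⟨ρ, hρ, hcost⟩ := exists_jointLaw_integral_le_zero hμ.prob (net.cost (net.minPower μ))
    (net.costBound (net.minPower μ)) (hμ.integrable_costBound _) (abs_cost_le _) (continuous_cost _)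
    (measurable_cost _) (by
      intro ε hε
      obtain ⟨_, ⟨π, hs, hp, rfl⟩, hlt⟩ := exists_lt_of_csInf_lt
        (⟨_, π₀, hs₀, hp₀, rfl⟩ : {P | ∃ π : Policy net μ, π.IsStable ∧ π.AvgPowerConstraint ∧
          π.avgEAP = P}.Nonempty) (lt_add_of_pos_right (net.minPower μ) hε)
      exact π.exists_jointLaw_integral_cost_le hμ hs hp hε hlt)
  have h0 := hcost (.inl ())
  rw [hρ.integral_cost_inl, sub_nonpos] at h0
  obtain ⟨ρ', hρ', hpAP, hp, hc, hrec⟩ := hρ.exists_integral_pAP_eq hμ h0 hle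
  refine ⟨ρ', hρ', hpAP, fun n s hn => ?_, fun n => ?_⟩
  · have h := hcost (.inr (.inl (n, s)))
    rw [hρ.integral_cost_queue hμ _ hn, sub_nonpos] at h
    simpa only [hc] using h
  · have h := hcost (.inr (.inr n))
    rw [hρ.integral_cost_power hμ, sub_nonpos] at h
    simp only [hp]
    exact h.trans (hrec n)

end WPCN

theorem theorem1 {𝕜 : Type} [RCLike 𝕜] {N L S M : ℕ} (net : WPCN 𝕜 N L S M)
    (μ : Measure (WPCN.State 𝕜 N L S M)) (hμ : net.IsStateLaw μ)
    (hcap : net.InCapacityRegion μ) :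
    ∃ π : WPCN.Policy net μ, π.IsStationary ∧
      π.avgEAP = net.minPower μ ∧
      (∀ t, π.meanEAP t = net.minPower μ) ∧
      (∀ t n s, n ≠ net.dst s →
        WPCN.arrivalRate μ n s + ∑ l ∈ net.inLinks n, π.meanRate t l s
          ≤ ∑ l ∈ net.outLinks n, π.meanRate t l s) ∧
      (∀ t n, ∑ l ∈ net.outLinks n, π.meanPower t l ≤ π.meanReceived t n) := by
  obtain ⟨ρ, hρ, hpAP, hqueue, hpower⟩ := WPCN.exists_jointLaw_minPower hμ hcap
  have := hρ.prob
  obtain ⟨π, hstat, hlaw⟩ := net.exists_stationary_policy μ ρ hρ.fst_eq hρ.feasible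
  have hlaw' (t : ℕ) : π.law t = ρ := hlaw t
  have hmean (t : ℕ) : π.meanEAP t = net.minPower μ := by rw [π.meanEAP_eq, hlaw', hpAP]
  refine ⟨π, hstat, ?_, hmean, ?_, ?_⟩
  · refine Tendsto.limsup_eq (tendsto_const_nhds.congr' ?_)
    filter_upwards [eventually_ne_atTop 0] with T hT
    simp only [hmean, Finset.sum_const, Finset.card_range, nsmul_eq_mul]
    rw [mul_div_cancel_left₀ _ (Nat.cast_ne_zero.2 hT)]
  · intro t n s hn
    simpa only [π.meanRate_eq, hlaw'] using hqueue n s hn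
  · intro t n
    simpa only [π.meanPower_eq, π.meanReceived_eq, hlaw'] using hpower n
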